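/- For a nonnegative integer $k$ let $(x;p)_k=\prod_{j=0}^{k-1}(1-xp^{j})$ and $(x_1,\dots,x_s;p)_k=(x_1;p)_k\cdots(x_s;p)_k$; for an integer $m$ let $[m]=(1-q^m)/(1-q)$, and let $\Phi_n(q)$ be the $n$-th cyclotomic polynomial. Let $K$ be a field of characteristic $0$. For rational functions $f,g\in K(q)$ and a polynomial $P\in K[q]$, write $f\equiv g\pmod P$ if $f-g=Pu/v$ with $u,v\in K[q]$ and $v$ coprime to $P$. **Theorem.** Let $n,d$ be positive integers and $r$ an integer such that $d+n-dn\le r\le n$, $\gcd(n,d)=1$ and $n\equiv r\pmod d$. Let $c\in K$ be nonzero; $c$ may be an indeterminate (take $K=\mathbb{Q}(c)$) or a number. Suppose that $c$ is not an $n$-th root of unity other than $1$, and that $(cq^{2r};q^d)_{(n-r)/d}\neq 0$ in $K(q)$ (which is automatic if $c\ne1$). Let $M=(n-r)/d$ or $M=n-1$. Then, modulo $[n]\Phi_n(q)^4$, $$\sum_{k=0}^{M}[2dk+r]\frac{(q^r;q^d)_k^5\,(cq^r;q^d)_k}{(q^d;q^d)_k^5\,(q^d/c;q^d)_k}\Big(\frac{q^{2d-3r}}{c}\Big)^k$$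 $$\equiv[n]\,(cq^r)^{(r-n)/d}\,\frac{(cq^{2r};q^d)_{(n-r)/d}}{(q^d/c;q^d)_{(n-r)/d}}\sum_{k=0}^{(n-r)/d}\frac{(q^r;q^d)_k^2\,(q^{d-r},cq^r;q^d)_k\,q^{dk}}{(q^d;q^d)_k^3\,(cq^{2r};q^d)_k}\bigg\{1-[n]^2(2-q^n)\sum_{j=1}^{k}\Big(\frac{q^{dj}}{[dj]^2}+\frac{q^{dj-d+r}}{[dj-d+r]^2}\Big)\bigg\}.$$ -/

import Mathlib

open Polynomial

noncomputable section

/-- The `q`-shifted factorial `(x; p)_k = (1 - x)(1 - x p) ⋯ (1 - x p ^ (k - 1))`. -/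
def qPoch {F : Type*} [Field F] (x p : F) (k : ℕ) : F :=
  ∏ j ∈ Finset.range k, (1 - x * p ^ j)

/-- The `q`-integer `[m] = (1 - q ^ m) / (1 - q)`, for an arbitrary integer `m`. -/
def qInt {F : Type*} [Field F] (q : F) (m : ℤ) : F :=
  (1 - q ^ m) / (1 - q)

/-- For a natural number `n`, the `q`-integer `[n] = 1 + q + ⋯ + q ^ (n - 1)` as a polynomial
in `q`. -/
def qIntPoly (K : Type*) [Field K] (n : ℕ) : K[X] :=
  ∑ i ∈ Finset.range n, (X : K[X]) ^ i

/-- The polynomial `qIntPoly K n`, seen as a rational function, is `[n]`. -/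
theorem algebraMap_qIntPoly (K : Type*) [Field K] (n : ℕ) :
    algebraMap K[X] (RatFunc K) (qIntPoly K n) = qInt (RatFunc.X : RatFunc K) n := by
  have h : (1 : RatFunc K) - RatFunc.X ≠ 0 := by
    intro h0
    have h1 : algebraMap K[X] (RatFunc K) (1 - X) = 0 := by
      rw [map_sub, map_one, RatFunc.algebraMap_X, h0]
    have h2 : (1 - X : K[X]) = 0 :=
      (map_eq_zero_iff _ (RatFunc.algebraMap_injective K)).1 h1
    have h3 := congrArg (Polynomial.eval (0 : K)) h2
    simp at h3
  rw [qInt, qIntPoly, eq_div_iff h, map_sum]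
  simp only [map_pow, RatFunc.algebraMap_X, zpow_natCast]
  exact geom_sum_mul_neg _ _

/-- Congruence of two rational functions `f`, `g` in `q` modulo a polynomial `P` in `q`: the
difference `f - g` can be written as `P * u / v`, where `u` and `v` are polynomials and `v` is
coprime to `P`.  (For `P` nonzero this says that `P` divides the numerator of the reduced form
of `f - g`.) -/
def RatCongr {K : Type*} [Field K] (P : K[X]) (f g : RatFunc K) : Prop :=
  ∃ u v : K[X], IsCoprime v P ∧
    f - g = algebraMap K[X] (RatFunc K) (P * u) / algebraMap K[X] (RatFunc K) v

/-- The sum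
`∑_{k=0}^{M} [2dk+r] (q^r;q^d)_k^5 (cq^r;q^d)_k / ((q^d;q^d)_k^5 (q^d/c;q^d)_k) (q^(2d-3r)/c)^k`. -/
def lhsSum {F : Type*} [Field F] (q c : F) (d : ℕ) (r : ℤ) (M : ℕ) : F :=
  ∑ k ∈ Finset.range (M + 1),
    qInt q (2 * d * k + r) *
      (qPoch (q ^ r) (q ^ d) k ^ 5 * qPoch (c * q ^ r) (q ^ d) k /
        (qPoch (q ^ d) (q ^ d) k ^ 5 * qPoch (q ^ d / c) (q ^ d) k)) *
      (q ^ (2 * (d : ℤ) - 3 * r) / c) ^ k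

/-- The inner sum `∑_{j=1}^{k} (q^(dj) / [dj]^2 + q^(dj-d+r) / [dj-d+r]^2)`. -/
def harmSum {F : Type*} [Field F] (q : F) (d : ℕ) (r : ℤ) (k : ℕ) : F :=
  ∑ j ∈ Finset.Icc 1 k,
    (q ^ (d * j) / qInt q (d * j) ^ 2 +
      q ^ ((d : ℤ) * j - d + r) / qInt q ((d : ℤ) * j - d + r) ^ 2)

/-- The right-hand side, where `N` is the number `(n - r) / d`:
`[n] (cq^r)^((r-n)/d) (cq^(2r);q^d)_N / (q^d/c;q^d)_N` times the sum over `0 ≤ k ≤ N` of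
`(q^r;q^d)_k^2 (q^(d-r);q^d)_k (cq^r;q^d)_k q^(dk) / ((q^d;q^d)_k^3 (cq^(2r);q^d)_k)`
times `1 - [n]^2 (2 - q^n) ∑_{j=1}^{k} (q^(dj) / [dj]^2 + q^(dj-d+r) / [dj-d+r]^2)`. -/
def rhsSum {F : Type*} [Field F] (q c : F) (n d : ℕ) (r : ℤ) (N : ℕ) : F :=
  qInt q n * (c * q ^ r) ^ ((r - n) / (d : ℤ)) *
    (qPoch (c * q ^ (2 * r)) (q ^ d) N / qPoch (q ^ d / c) (q ^ d) N) *
    ∑ k ∈ Finset.range (N + 1),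
      qPoch (q ^ r) (q ^ d) k ^ 2 *
          (qPoch (q ^ ((d : ℤ) - r)) (q ^ d) k * qPoch (c * q ^ r) (q ^ d) k) * q ^ (d * k) /
        (qPoch (q ^ d) (q ^ d) k ^ 3 * qPoch (c * q ^ (2 * r)) (q ^ d) k) *
      (1 - qInt q n ^ 2 * (2 - q ^ n) * harmSum q d r k)

end

/-!
The modulus only involves primes of `K[q]` at which `q` reduces to a primitive `m`-th root of unity
with `1 ≠ m ∣ n`; there `1 - q ^ n` is a uniformizer, and it suffices to bound the order of
vanishing of the difference of the two sides in the corresponding valuation ring of `K(q)`.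

At every such place each side vanishes: on the left, blocks of `m` consecutive summands cancel
modulo the place by the antisymmetry of very-well-poised series; on the right, because of `[n]`.

For `m = n` five orders are needed.  Replacing a pair of parameters `x, x` of Watson's
transformation by `x q ^ n, x q ^ (-n)` multiplies the `k`-th summand by a factor `1 + O(ε)`, where
`ε = 2 - q ^ n - q ^ (-n)` has order two.  Shifting one pair, respectively two, makes the
transformation evaluate exactly the left side with weights `f_k`, respectively `f_k ^ 2`, where
`f_k = 1 + O(ε)`.  As `2 f_k - f_k ^ 2 = 1 - (1 - f_k) ^ 2`, the corresponding combination of the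
two evaluations changes the left side by terms of order four, and antisymmetry provides one more
order.  The same combination on the right produces the weights `1 + ε (…) + O(ε²)` whose linear
term is the sum over `j`; there the fifth order comes from `[n]`.
-/

section QPochhammer

variable {F : Type*} [Field F]

@[simp] lemma qPoch_zero (x p : F) : qPoch x p 0 = 1 := by simp [qPoch]

lemma qPoch_succ (x p : F) (k : ℕ) : qPoch x p (k + 1) = qPoch x p k * (1 - x * p ^ k) :=
  Finset.prod_range_succ _ _

lemma qPoch_add (x p : F) (k l : ℕ) :
    qPoch x p (k + l) = qPoch x p k * qPoch (x * p ^ k) p l := by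
  simp only [qPoch, Finset.prod_range_add, pow_add, mul_assoc]

lemma qPoch_succ' (x p : F) (k : ℕ) : qPoch x p (k + 1) = (1 - x) * qPoch (x * p) p k := by
  rw [add_comm, qPoch_add]; simp [qPoch]

lemma qPoch_ne_zero_iff {x p : F} {k : ℕ} : qPoch x p k ≠ 0 ↔ ∀ j < k, 1 - x * p ^ j ≠ 0 := by
  simp [qPoch, Finset.prod_ne_zero_iff]

lemma qPoch_ne_zero_of_le {x p : F} {k l : ℕ} (h : qPoch x p l ≠ 0) (hkl : k ≤ l) :
    qPoch x p k ≠ 0 :=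
  qPoch_ne_zero_iff.2 fun j hj => qPoch_ne_zero_iff.1 h j (hj.trans_le hkl)

lemma qPoch_mul_one_sub (x p : F) (j : ℕ) :
    qPoch x p j * (1 - x * p ^ j) = (1 - x) * qPoch (x * p) p j := by
  rw [← qPoch_succ, qPoch_succ']

lemma qPoch_inv_pow_eq_zero {p : F} (hp : p ≠ 0) {k j : ℕ} (h : k < j) :
    qPoch (p ^ k)⁻¹ p j = 0 :=
  Finset.prod_eq_zero (Finset.mem_range.2 h) (by simp [hp])

/-- The summand of the terminating `₃φ₂` series of the `q`-Pfaff–Saalschütz sum. -/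
def saalTerm (p α l B C : F) (k j : ℕ) : F :=
  qPoch (p ^ k)⁻¹ p j * qPoch (α * p ^ k) p j * qPoch l p j * p ^ j /
    (qPoch p p j * qPoch B p j * qPoch C p j)

lemma sum_range_saalTerm_recurrence {p α l B C : F} (hp : p ≠ 0) (hBC : B * C = α * p * l)
    (k J : ℕ) (h1 : qPoch p p J ≠ 0) (h2 : qPoch B p J ≠ 0) (h3 : qPoch C p J ≠ 0) :
    ∑ j ∈ Finset.range (J + 1), ((1 - B * p ^ k) * (1 - C * p ^ k) * saalTerm p α l B C (k + 1) j -
        (l - (B + C) * p ^ k + α * p * (p ^ k) ^ 2) * saalTerm p α l B C k j) =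
      (1 - α * p * (p ^ k) ^ 2) * (qPoch (p ^ k)⁻¹ p J * qPoch (α * p ^ (k + 1)) p J *
        qPoch l p (J + 1) / (qPoch p p J * qPoch B p J * qPoch C p J)) := by
  induction J with
  | zero =>
    simp only [zero_add, Finset.sum_range_one, saalTerm, qPoch_succ, qPoch_zero]
    simp only [pow_zero]
    linear_combination (p ^ k) ^ 2 * hBC
  | succ J ih =>
    rw [Finset.sum_range_succ, ih (qPoch_ne_zero_of_le h1 J.le_succ)
      (qPoch_ne_zero_of_le h2 J.le_succ) (qPoch_ne_zero_of_le h3 J.le_succ)]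
    have hk : (p ^ (k + 1))⁻¹ * p = (p ^ k)⁻¹ := by rw [pow_succ]; field_simp
    have hαk : α * p ^ k * p = α * p ^ (k + 1) := by ring
    rw [qPoch_succ] at h1 h2 h3
    have hB : 1 - p ^ J * B ≠ 0 := by rw [mul_comm]; exact right_ne_zero_of_mul h2
    have hC : 1 - p ^ J * C ≠ 0 := by rw [mul_comm]; exact right_ne_zero_of_mul h3
    have hJ := right_ne_zero_of_mul h1
    have hx : p ^ k ≠ 0 := pow_ne_zero k hp
    have h1' := left_ne_zero_of_mul h1
    have h2' := left_ne_zero_of_mul h2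
    have h3' := left_ne_zero_of_mul h3
    simp only [saalTerm, qPoch_succ' (p ^ (k + 1))⁻¹, qPoch_succ' (α * p ^ k), hk, hαk]
    simp only [qPoch_succ _ p (J + 1), qPoch_succ _ p J]
    generalize qPoch (p ^ k)⁻¹ p J = U, qPoch (α * p ^ (k + 1)) p J = V, qPoch l p J = W
    simp only [pow_succ] at *
    generalize p ^ k = x at *
    generalize p ^ J = y at *
    rw [← sub_eq_zero]
    field_simp
    linear_combination U * V * W * (1 - l * y) *
      (x * y ^ 2 * (1 - α * p * x ^ 2) * (1 - p * y) +
        y * x ^ 2 * (p * x - 1) * (1 - α * p * x * y)) * hBC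

/-- The parameters of the `q`-Pfaff–Saalschütz sum are arranged so that it expands
`(β, γ; p)_k l ^ k / (lγ, lβ; p)_k` in the basis `(p ^ (-k), αp ^ k; p)_j`. -/
lemma sum_saalTerm {p α l β γ : F} (hp : p ≠ 0) (hα : l * β * γ = α * p) (k : ℕ)
    (h1 : qPoch p p k ≠ 0) (h2 : qPoch (l * γ) p k ≠ 0) (h3 : qPoch (l * β) p k ≠ 0) :
    ∑ j ∈ Finset.range (k + 1), saalTerm p α l (l * γ) (l * β) k j =
      qPoch β p k * qPoch γ p k * l ^ k / (qPoch (l * γ) p k * qPoch (l * β) p k) := by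
  induction k with
  | zero => simp [saalTerm]
  | succ k ih =>
    have ih := ih (qPoch_ne_zero_of_le h1 k.le_succ) (qPoch_ne_zero_of_le h2 k.le_succ)
      (qPoch_ne_zero_of_le h3 k.le_succ)
    have hlast : saalTerm p α l (l * γ) (l * β) k (k + 1) = 0 := by
      simp [saalTerm, qPoch_inv_pow_eq_zero hp k.lt_succ_self]
    have key := sum_range_saalTerm_recurrence (α := α) hp
      (show (l * γ) * (l * β) = α * p * l by rw [← hα]; ring) k (k + 1) h1 h2 h3
    rw [qPoch_inv_pow_eq_zero hp k.lt_succ_self, Finset.sum_sub_distrib, ← Finset.mul_sum,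
      ← Finset.mul_sum, Finset.sum_range_succ (fun j => saalTerm p α l (l * γ) (l * β) k j), hlast,
      add_zero, ih] at key
    have hfactor : l - (l * γ + l * β) * p ^ k + α * p * (p ^ k) ^ 2 =
        (1 - β * p ^ k) * (1 - γ * p ^ k) * l := by
      linear_combination -(p ^ k) ^ 2 * hα
    rw [qPoch_succ] at h2 h3
    have g2 := right_ne_zero_of_mul h2
    have g3 := right_ne_zero_of_mul h3
    rw [hfactor, zero_mul, zero_mul, zero_div, mul_zero, sub_eq_zero] at key
    apply mul_left_cancel₀ (mul_ne_zero g2 g3)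
    rw [key]
    simp only [qPoch_succ _ p k, pow_succ l]
    rw [mul_mul_mul_comm (qPoch (l * γ) p k), ← mul_div_assoc, ← mul_div_assoc,
      mul_comm (qPoch (l * γ) p k * _), ← mul_div_mul_left _ (_ * _) (mul_ne_zero g2 g3)]
    ring

lemma qPoch_div_qPoch_succ (x p : F) {y : F} {k : ℕ} (h : 1 - y * p ^ k ≠ 0) :
    qPoch x p (k + 1) / qPoch y p (k + 1) * (1 - y * p ^ k) =
      qPoch x p k / qPoch y p k * (1 - x * p ^ k) := by
  rw [qPoch_succ, qPoch_succ, mul_div_mul_comm, mul_assoc, div_mul_cancel₀ _ h]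

/-- The summand, without its very-well-poised factor `1 - α p ^ (2k)`, of a terminating
very-well-poised `₆φ₅` series with parameters `δ`, `e`, `p ^ (-N)`, multiplied by the basis element
`(p ^ (-k), αp ^ k; p)_j`, whose factor `(p ^ (-k); p)_j` restricts the sum to `j ≤ k`. -/
def wpTerm (p α δ e : F) (N j k : ℕ) : F :=
  qPoch α p k / qPoch p p k * (qPoch δ p k / qPoch (α * p / δ) p k) *
    (qPoch e p k / qPoch (α * p / e) p k) *
    (qPoch (p ^ N)⁻¹ p k / qPoch (α * p ^ (N + 1)) p k) *
    (α * p ^ (N + 1) / (δ * e)) ^ k * (qPoch (p ^ k)⁻¹ p j * qPoch (α * p ^ k) p j)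

lemma wpTerm_eq_zero_of_lt {p : F} (hp : p ≠ 0) (α δ e : F) (N : ℕ) {j k : ℕ} (h : k < j) :
    wpTerm p α δ e N j k = 0 := by
  simp [wpTerm, qPoch_inv_pow_eq_zero hp h]

lemma wpTerm_succ_left (p α δ e : F) (N j k : ℕ) :
    wpTerm p α δ e N (j + 1) k =
      wpTerm p α δ e N j k * ((1 - p ^ j / p ^ k) * (1 - α * p ^ k * p ^ j)) := by
  simp only [wpTerm, qPoch_succ _ p j]
  ring

lemma qPoch_inv_pow_succ {p : F} (hp : p ≠ 0) (k j : ℕ) :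
    qPoch (p ^ (k + 1))⁻¹ p j * (p ^ (k + 1) - p ^ j) = -(1 - p * p ^ k) * qPoch (p ^ k)⁻¹ p j := by
  have h := qPoch_mul_one_sub (p ^ (k + 1))⁻¹ p j
  rw [show (p ^ (k + 1))⁻¹ * p = (p ^ k)⁻¹ by rw [pow_succ]; field_simp, inv_mul_eq_div,
    one_sub_div (pow_ne_zero _ hp), mul_div_assoc', div_eq_iff (pow_ne_zero _ hp)] at h
  rw [h, mul_right_comm, sub_mul, inv_mul_cancel₀ (pow_ne_zero _ hp)]
  ring

lemma wpTerm_succ_right {p α δ e : F} (hp : p ≠ 0) (N j k : ℕ)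
    (h1 : 1 - p * p ^ k ≠ 0) (h2 : 1 - α * p / δ * p ^ k ≠ 0) (h3 : 1 - α * p / e * p ^ k ≠ 0)
    (h4 : 1 - α * p ^ (N + 1) * p ^ k ≠ 0) :
    wpTerm p α δ e N j (k + 1) * ((1 - α * p / δ * p ^ k) * (1 - α * p / e * p ^ k) *
        (1 - α * p ^ (N + 1) * p ^ k) * (p ^ (k + 1) - p ^ j)) =
      - (wpTerm p α δ e N j k * ((1 - δ * p ^ k) * (1 - e * p ^ k) * (1 - p ^ k / p ^ N) *
        (α * p ^ (N + 1) / (δ * e)) * (1 - α * p ^ k * p ^ j))) := by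
  have hpos : qPoch (α * p ^ k) p j * (1 - α * p ^ k * p ^ j) =
      (1 - α * p ^ k) * qPoch (α * p ^ (k + 1)) p j := by
    rw [qPoch_mul_one_sub, mul_assoc α, ← pow_succ]
  have hδ := qPoch_div_qPoch_succ δ p h2
  have he := qPoch_div_qPoch_succ e p h3
  have hN := qPoch_div_qPoch_succ (p ^ N)⁻¹ p h4
  simp only [wpTerm]
  generalize qPoch δ p (k + 1) / qPoch (α * p / δ) p (k + 1) = D at *
  generalize qPoch e p (k + 1) / qPoch (α * p / e) p (k + 1) = E at *
  generalize qPoch (p ^ N)⁻¹ p (k + 1) / qPoch (α * p ^ (N + 1)) p (k + 1) = V at *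
  generalize α * p ^ (N + 1) / (δ * e) = μ
  calc
    _ = qPoch α p (k + 1) / qPoch p p (k + 1) * (D * (1 - α * p / δ * p ^ k)) *
          (E * (1 - α * p / e * p ^ k)) * (V * (1 - α * p ^ (N + 1) * p ^ k)) * μ ^ (k + 1) *
          (qPoch (p ^ (k + 1))⁻¹ p j * (p ^ (k + 1) - p ^ j)) *
          qPoch (α * p ^ (k + 1)) p j := by ring
    _ = -(qPoch α p (k + 1) / qPoch p p (k + 1) * (1 - p * p ^ k)) *
          (D * (1 - α * p / δ * p ^ k)) * (E * (1 - α * p / e * p ^ k)) *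
          (V * (1 - α * p ^ (N + 1) * p ^ k)) * μ ^ (k + 1) * qPoch (p ^ k)⁻¹ p j *
          qPoch (α * p ^ (k + 1)) p j := by rw [qPoch_inv_pow_succ hp k j]; ring
    _ = _ := by
      rw [qPoch_div_qPoch_succ α p h1, hδ, he, hN, div_eq_inv_mul (p ^ k)]
      linear_combination (qPoch α p k / qPoch p p k *
        (qPoch δ p k / qPoch (α * p / δ) p k * (1 - δ * p ^ k)) *
        (qPoch e p k / qPoch (α * p / e) p k * (1 - e * p ^ k)) *
        (qPoch (p ^ N)⁻¹ p k / qPoch (α * p ^ (N + 1)) p k * (1 - (p ^ N)⁻¹ * p ^ k)) *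
        μ ^ (k + 1) * qPoch (p ^ k)⁻¹ p j) * hpos

lemma sum_wpTerm_recurrence {p α δ e : F} (hp : p ≠ 0) (hα : α ≠ 0) (hδ : δ ≠ 0) (he : e ≠ 0)
    (N j K : ℕ) (h1 : qPoch p p K ≠ 0) (h2 : qPoch (α * p / δ) p K ≠ 0)
    (h3 : qPoch (α * p / e) p K ≠ 0) (h4 : qPoch (α * p ^ (N + 1)) p K ≠ 0) :
    ∑ k ∈ Finset.range (K + 1), (1 - α * (p ^ k) ^ 2) *
        ((1 - δ * e / (α * p ^ N) * p ^ j) * wpTerm p α δ e N (j + 1) k -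
          (1 - δ * p ^ j) * (1 - e * p ^ j) * (1 - p ^ j / p ^ N) * wpTerm p α δ e N j k) =
      - (p ^ j * wpTerm p α δ e N j K / p ^ K * ((1 - δ * p ^ K) * (1 - e * p ^ K) *
        (1 - p ^ K / p ^ N) * (1 - α * p ^ K * p ^ j))) := by
  simp only [wpTerm_succ_left]
  induction K with
  | zero =>
    rcases j with _ | j
    · simp only [zero_add, Finset.sum_range_one, pow_zero]; ring
    · simp [wpTerm_eq_zero_of_lt hp _ _ _ _ j.succ_pos]
  | succ K ih =>
    rw [Finset.sum_range_succ, ih (qPoch_ne_zero_of_le h1 K.le_succ)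
      (qPoch_ne_zero_of_le h2 K.le_succ) (qPoch_ne_zero_of_le h3 K.le_succ)
      (qPoch_ne_zero_of_le h4 K.le_succ)]
    have key := wpTerm_succ_right hp N j K (qPoch_ne_zero_iff.1 h1 K K.lt_succ_self)
      (qPoch_ne_zero_iff.1 h2 K K.lt_succ_self) (qPoch_ne_zero_iff.1 h3 K K.lt_succ_self)
      (qPoch_ne_zero_iff.1 h4 K K.lt_succ_self)
    generalize wpTerm p α δ e N j (K + 1) = T1 at *
    generalize wpTerm p α δ e N j K = T0 at *
    have hx : p ^ K ≠ 0 := pow_ne_zero _ hp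
    have hN : p ^ N ≠ 0 := pow_ne_zero _ hp
    simp only [pow_succ _ K, pow_succ _ N] at *
    clear ih h1 h2 h3 h4
    generalize p ^ K = x at *
    generalize p ^ j = y at *
    generalize p ^ N = z at *
    have key' : T0 * ((1 - δ * x) * (1 - e * x) * (1 - x / z) * (1 - α * x * y)) =
        - (T1 * ((1 - α * p / δ * x) * (1 - α * p / e * x) * (1 - α * (z * p) * x) * (x * p - y)) *
          (δ * e / (α * (z * p)))) := by
      rw [key]; field_simp
    rw [div_mul_eq_mul_div, mul_assoc y, key']
    field_simp
    ring

lemma qPoch_reflect {p : F} (hp : p ≠ 0) {a : F} (ha : a ≠ 0) (N : ℕ) :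
    qPoch (p / (a * p ^ N)) p N * a ^ N = qPoch a p N * ∏ i ∈ Finset.range N, (-(p ^ i)⁻¹) := by
  rw [qPoch, ← Finset.prod_range_reflect, qPoch, ← Finset.prod_mul_distrib]
  rw [show a ^ N = a ^ (Finset.range N).card by rw [Finset.card_range], Finset.prod_mul_pow_card]
  refine Finset.prod_congr rfl fun i hi => ?_
  obtain ⟨m, rfl⟩ : ∃ m, N = i + 1 + m := Nat.exists_eq_add_of_le (Finset.mem_range.1 hi)
  rw [show i + 1 + m - 1 - i = m by omega, pow_add, pow_add, pow_one]
  field_simp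
  ring

lemma qPoch_reflect_mul {p : F} (hp : p ≠ 0) {a b : F} (ha : a ≠ 0) (hb : b ≠ 0) (N : ℕ) :
    qPoch (p / (a * p ^ N)) p N * a ^ N * qPoch b p N =
      qPoch (p / (b * p ^ N)) p N * b ^ N * qPoch a p N := by
  rw [qPoch_reflect hp ha, qPoch_reflect hp hb]; ring

lemma wpTerm_self {p α δ e : F} (hp : p ≠ 0) (hα : α ≠ 0) (hδ : δ ≠ 0) (he : e ≠ 0) (N : ℕ)
    (h1 : qPoch p p N ≠ 0) (h4 : qPoch (α * p ^ (N + 1)) p N ≠ 0) :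
    (1 - α * (p ^ N) ^ 2) * wpTerm p α δ e N N N * qPoch (δ * e / (α * p ^ N)) p N =
      (1 - α) * qPoch (α * p) p N * qPoch (α * p / (δ * e)) p N /
          (qPoch (α * p / δ) p N * qPoch (α * p / e) p N) *
        (qPoch δ p N * qPoch e p N * qPoch (p ^ N)⁻¹ p N) := by
  have hN : p ^ N ≠ 0 := pow_ne_zero _ hp
  have hα1 : qPoch α p N * (1 - α * p ^ N) = (1 - α) * qPoch (α * p) p N :=
    qPoch_mul_one_sub α p N
  have hα2 : qPoch (α * p ^ N) p N * (1 - α * (p ^ N) ^ 2) / qPoch (α * p ^ (N + 1)) p N =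
      1 - α * p ^ N := by
    rw [pow_two, ← mul_assoc, qPoch_mul_one_sub, mul_assoc α, ← pow_succ,
      mul_div_cancel_right₀ _ h4]
  have hrefl : qPoch (p ^ N)⁻¹ p N * qPoch (δ * e / (α * p ^ N)) p N / qPoch p p N *
      (α * p ^ (N + 1) / (δ * e)) ^ N = qPoch (α * p / (δ * e)) p N := by
    have ha : δ * e / (α * p ^ N) ≠ 0 := div_ne_zero (mul_ne_zero hδ he) (mul_ne_zero hα hN)
    have h := qPoch_reflect_mul hp ha hp N
    rw [show p / (δ * e / (α * p ^ N) * p ^ N) = α * p / (δ * e) by field_simp,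
      show p / (p * p ^ N) = (p ^ N)⁻¹ by field_simp] at h
    rw [show α * p ^ (N + 1) / (δ * e) = p / (δ * e / (α * p ^ N)) by
        rw [pow_succ]; field_simp, div_pow,
      div_mul_div_comm, div_eq_iff (mul_ne_zero h1 (pow_ne_zero _ ha))]
    linear_combination -h
  rw [← hrefl, ← hα1, ← hα2, wpTerm]
  ring

/-- Multiplying by `(δe / (αp ^ N); p)_j` keeps the sum meaningful when this factor vanishes. -/
lemma sum_wpTerm {p α δ e : F} (hp : p ≠ 0) (hα : α ≠ 0) (hδ : δ ≠ 0) (he : e ≠ 0) (N : ℕ)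
    (h1 : qPoch p p N ≠ 0) (h2 : qPoch (α * p / δ) p N ≠ 0) (h3 : qPoch (α * p / e) p N ≠ 0)
    (h4 : qPoch (α * p ^ (N + 1)) p N ≠ 0) (h5 : qPoch δ p N ≠ 0) (h6 : qPoch e p N ≠ 0)
    {j : ℕ} (hj : j ≤ N) :
    (∑ k ∈ Finset.range (N + 1), (1 - α * (p ^ k) ^ 2) * wpTerm p α δ e N j k) *
        qPoch (δ * e / (α * p ^ N)) p j =
      (1 - α) * qPoch (α * p) p N * qPoch (α * p / (δ * e)) p N /
          (qPoch (α * p / δ) p N * qPoch (α * p / e) p N) *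
        (qPoch δ p j * qPoch e p j * qPoch (p ^ N)⁻¹ p j) := by
  have hN : p ^ N ≠ 0 := pow_ne_zero _ hp
  induction hj using Nat.decreasingInduction with
  | self =>
    rw [Finset.sum_eq_single_of_mem N (Finset.self_mem_range_succ N) fun k hk hkN => ?_]
    · exact wpTerm_self hp hα hδ he N h1 h4
    · rw [wpTerm_eq_zero_of_lt hp _ _ _ _ ((Finset.mem_range_succ_iff.1 hk).lt_of_ne hkN), mul_zero]
  | of_succ j hj ih =>
    have key := sum_wpTerm_recurrence hp hα hδ he N j N h1 h2 h3 h4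
    simp only [div_self hN, sub_self, mul_zero, zero_mul, neg_zero, mul_sub,
      Finset.sum_sub_distrib, mul_left_comm (1 - α * _), ← Finset.mul_sum, sub_eq_zero] at key
    simp only [qPoch_succ _ p j] at ih
    have g1 := qPoch_ne_zero_iff.1 h5 j hj
    have g2 := qPoch_ne_zero_iff.1 h6 j hj
    have g3 : 1 - (p ^ N)⁻¹ * p ^ j ≠ 0 := fun h => by
      have := qPoch_ne_zero_iff.1 h1 (N - j - 1) (by omega)
      rw [← pow_succ', show N - j - 1 + 1 = N - j by omega, pow_sub₀ _ hp hj.le] at this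
      rw [inv_mul_eq_div, sub_eq_zero, eq_comm, div_eq_one_iff_eq hN] at h
      rw [← div_eq_mul_inv, h, div_self hN, sub_self] at this
      exact this rfl
    apply mul_left_cancel₀ (mul_ne_zero (mul_ne_zero g1 g2) g3)
    linear_combination ih - qPoch (δ * e / (α * p ^ N)) p j * key

/-- Watson's transformation of a terminating very-well-poised `₈φ₇` series into a balanced `₄φ₃`
series. -/
lemma watson {p α δ e l β γ : F} (hp : p ≠ 0) (hα : α ≠ 0) (hδ : δ ≠ 0) (he : e ≠ 0) (N : ℕ)
    (hl : l * β * γ = α * p)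
    (h1 : qPoch p p N ≠ 0) (h2 : qPoch (α * p / δ) p N ≠ 0) (h3 : qPoch (α * p / e) p N ≠ 0)
    (h4 : qPoch (α * p ^ (N + 1)) p N ≠ 0) (h5 : qPoch δ p N ≠ 0) (h6 : qPoch e p N ≠ 0)
    (h7 : qPoch (l * γ) p N ≠ 0) (h8 : qPoch (l * β) p N ≠ 0)
    (h9 : qPoch (δ * e / (α * p ^ N)) p N ≠ 0) :
    ∑ k ∈ Finset.range (N + 1), (1 - α * (p ^ k) ^ 2) * wpTerm p α δ e N 0 k *
        (qPoch β p k * qPoch γ p k * l ^ k / (qPoch (l * γ) p k * qPoch (l * β) p k)) =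
      (1 - α) * qPoch (α * p) p N * qPoch (α * p / (δ * e)) p N /
          (qPoch (α * p / δ) p N * qPoch (α * p / e) p N) *
        ∑ j ∈ Finset.range (N + 1),
          qPoch δ p j * qPoch e p j * qPoch (p ^ N)⁻¹ p j * qPoch l p j * p ^ j /
            (qPoch p p j * qPoch (l * γ) p j * qPoch (l * β) p j *
              qPoch (δ * e / (α * p ^ N)) p j) := by
  have expand : ∀ k ∈ Finset.range (N + 1), (1 - α * (p ^ k) ^ 2) * wpTerm p α δ e N 0 k *
      (qPoch β p k * qPoch γ p k * l ^ k / (qPoch (l * γ) p k * qPoch (l * β) p k)) =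
      ∑ j ∈ Finset.range (N + 1), (qPoch l p j * p ^ j /
        (qPoch p p j * qPoch (l * γ) p j * qPoch (l * β) p j)) *
        ((1 - α * (p ^ k) ^ 2) * wpTerm p α δ e N j k) := by
    intro k hk
    have hk' : k ≤ N := Finset.mem_range_succ_iff.1 hk
    rw [← sum_saalTerm hp hl k (qPoch_ne_zero_of_le h1 hk') (qPoch_ne_zero_of_le h7 hk')
      (qPoch_ne_zero_of_le h8 hk'), Finset.mul_sum]
    refine Finset.sum_subset_zero_on_sdiff
      (Finset.range_subset_range.2 (Nat.succ_le_succ hk')) (fun j hj => ?_) fun j _ => ?_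
    · rw [Finset.mem_sdiff, Finset.mem_range_succ_iff, Finset.mem_range_succ_iff] at hj
      rw [wpTerm_eq_zero_of_lt hp _ _ _ _ (not_le.1 hj.2), mul_zero, mul_zero]
    · simp only [wpTerm, saalTerm, qPoch_zero]
      ring
  rw [Finset.sum_congr rfl expand, Finset.sum_comm, Finset.mul_sum]
  refine Finset.sum_congr rfl fun j hj => ?_
  have hj' : j ≤ N := Finset.mem_range_succ_iff.1 hj
  rw [← Finset.mul_sum, eq_div_of_mul_eq (qPoch_ne_zero_of_le h9 hj')
    (sum_wpTerm hp hα hδ he N h1 h2 h3 h4 h5 h6 hj')]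
  ring

end QPochhammer

section Residue

open IsLocalRing

variable {F : Type*} [Field F] {O : ValuationSubring F} {x x' : F} {y y' : ResidueField O}

/-- The element `x` of `F` lies in the valuation ring `O` and `y` is its image in the residue field
of `O`; a relation rather than a function, as `x` may have a pole. -/
def HasResidue (O : ValuationSubring F) (x : F) (y : ResidueField O) : Prop :=
  ∃ a : O, (a : F) = x ∧ residue O a = y

lemma exists_hasResidue (h : O.valuation x ≤ 1) : ∃ y, HasResidue O x y :=
  ⟨_, ⟨x, (O.valuation_le_one_iff x).1 h⟩, rfl, rfl⟩

namespace HasResidue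

lemma one : HasResidue O 1 1 := ⟨1, rfl, map_one _⟩

lemma natCast (k : ℕ) : HasResidue O (k : F) (k : ResidueField O) := ⟨k, by simp, map_natCast _ k⟩

lemma add (h : HasResidue O x y) (h' : HasResidue O x' y') : HasResidue O (x + x') (y + y') := by
  obtain ⟨a, rfl, rfl⟩ := h
  obtain ⟨b, rfl, rfl⟩ := h'
  exact ⟨a + b, rfl, map_add _ _ _⟩

lemma sub (h : HasResidue O x y) (h' : HasResidue O x' y') : HasResidue O (x - x') (y - y') := by
  obtain ⟨a, rfl, rfl⟩ := h
  obtain ⟨b, rfl, rfl⟩ := h'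
  exact ⟨a - b, rfl, map_sub _ _ _⟩

lemma neg (h : HasResidue O x y) : HasResidue O (-x) (-y) := by
  obtain ⟨a, rfl, rfl⟩ := h
  exact ⟨-a, rfl, map_neg _ _⟩

lemma mul (h : HasResidue O x y) (h' : HasResidue O x' y') : HasResidue O (x * x') (y * y') := by
  obtain ⟨a, rfl, rfl⟩ := h
  obtain ⟨b, rfl, rfl⟩ := h'
  exact ⟨a * b, rfl, map_mul _ _ _⟩

lemma pow (h : HasResidue O x y) (k : ℕ) : HasResidue O (x ^ k) (y ^ k) := by
  obtain ⟨a, rfl, rfl⟩ := h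
  exact ⟨a ^ k, rfl, map_pow _ _ _⟩

lemma sum {ι : Type*} {s : Finset ι} {f : ι → F} {g : ι → ResidueField O}
    (h : ∀ i ∈ s, HasResidue O (f i) (g i)) : HasResidue O (∑ i ∈ s, f i) (∑ i ∈ s, g i) := by
  classical
  induction s using Finset.induction_on with
  | empty => exact ⟨0, rfl, map_zero _⟩
  | insert i s hi ih =>
    rw [Finset.sum_insert hi, Finset.sum_insert hi]
    exact (h i (Finset.mem_insert_self i s)).add
      (ih fun j hj => h j (Finset.mem_insert_of_mem hj))

lemma mem (h : HasResidue O x y) : x ∈ O := by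
  obtain ⟨a, rfl, -⟩ := h
  exact a.2

lemma valuation_le_one (h : HasResidue O x y) : O.valuation x ≤ 1 :=
  (O.valuation_le_one_iff x).2 h.mem

lemma valuation_eq_one (h : HasResidue O x y) (hy : y ≠ 0) : O.valuation x = 1 := by
  obtain ⟨a, rfl, rfl⟩ := h
  exact (O.valuation_eq_one_iff a).1 ((residue_ne_zero_iff_isUnit a).1 hy)

lemma valuation_lt_one (h : HasResidue O x 0) : O.valuation x < 1 := by
  obtain ⟨a, rfl, ha⟩ := h
  exact (O.valuation_lt_one_iff a).1 ((residue_eq_zero_iff a).1 ha)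

lemma ne_zero (h : HasResidue O x y) (hy : y ≠ 0) : x ≠ 0 := by
  rintro rfl
  simpa using h.valuation_eq_one hy

lemma unique (h : HasResidue O x y) (h' : HasResidue O x y') : y = y' := by
  obtain ⟨a, rfl, rfl⟩ := h
  obtain ⟨b, hb, rfl⟩ := h'
  rw [Subtype.ext hb]

lemma inv (h : HasResidue O x y) (hy : y ≠ 0) : HasResidue O x⁻¹ y⁻¹ := by
  obtain ⟨z, hz⟩ : ∃ z, HasResidue O x⁻¹ z :=
    exists_hasResidue (by rw [map_inv₀, h.valuation_eq_one hy, inv_one])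
  have hx : HasResidue O (x * x⁻¹) 1 := by
    rw [mul_inv_cancel₀ (h.ne_zero hy)]
    exact one
  rwa [inv_eq_of_mul_eq_one_right ((h.mul hz).unique hx)]

lemma div (h : HasResidue O x y) (h' : HasResidue O x' y') (hy' : y' ≠ 0) :
    HasResidue O (x / x') (y / y') := by
  rw [div_eq_mul_inv, div_eq_mul_inv]
  exact h.mul (h'.inv hy')

lemma zpow (h : HasResidue O x y) (hy : y ≠ 0) (k : ℤ) : HasResidue O (x ^ k) (y ^ k) := by
  obtain ⟨k, rfl | rfl⟩ := k.eq_nat_or_neg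
  · simpa only [zpow_natCast] using h.pow k
  · simpa only [zpow_neg, zpow_natCast] using (h.pow k).inv (pow_ne_zero k hy)

lemma qPoch {p : F} {z : ResidueField O} (h : HasResidue O x y) (hp : HasResidue O p z) (k : ℕ) :
    HasResidue O (qPoch x p k) (qPoch y z k) := by
  induction k with
  | zero => simpa only [qPoch_zero] using one
  | succ k ih => simpa only [qPoch_succ] using ih.mul (one.sub (h.mul (hp.pow k)))

lemma qInt (h : HasResidue O x y) (hy : y ≠ 0) (hy1 : y ≠ 1) (k : ℤ) :
    HasResidue O (qInt x k) (qInt y k) :=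
  (one.sub (h.zpow hy k)).div (one.sub h) (sub_ne_zero.2 hy1.symm)

lemma one_sub_zpow_div (h : HasResidue O x 1) (hx : x ≠ 1) (a : ℤ) :
    HasResidue O ((1 - x ^ a) / (1 - x)) a := by
  have hpos (k : ℕ) : HasResidue O ((1 - x ^ k) / (1 - x)) k := by
    rw [← mul_neg_geom_sum, mul_div_cancel_left₀ _ (sub_ne_zero.2 hx.symm)]
    simpa using sum fun i (_ : i ∈ Finset.range k) => h.pow i
  obtain ⟨k, rfl | rfl⟩ := a.eq_nat_or_neg
  · simpa using hpos k
  · have hk : 1 - x ^ (-(k : ℤ)) = (x ^ k)⁻¹ * (x ^ k - 1) := by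
      rw [mul_sub_one, inv_mul_cancel₀ (pow_ne_zero k (h.ne_zero one_ne_zero)), zpow_neg,
        zpow_natCast]
    rw [hk, ← neg_sub 1 (x ^ k), mul_neg, neg_div, mul_div_assoc]
    simpa using (((h.pow k).inv (pow_ne_zero k one_ne_zero)).mul (hpos k)).neg

end HasResidue

end Residue

section CyclotomicPlace

open IsLocalRing

/-- The valuation ring `O` is the place of a `q`-line at a root of unity: `q` reduces to a primitive
`m`-th root of unity `ζ` with `m ∣ n`, and `1 - q ^ n` is a uniformizer.  The order of vanishing of
`x` is at least `e` precisely when `O.valuation x ≤ O.valuation (1 - q ^ n) ^ e`. -/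
structure IsCyclotomicPlace {F : Type*} [Field F] (O : ValuationSubring F) (q : F)
    (ζ : ResidueField O) (m n : ℕ) : Prop where
  hasResidue : HasResidue O q ζ
  isPrimitiveRoot : IsPrimitiveRoot ζ m
  dvd : m ∣ n
  pow_ne_one : q ^ n ≠ 1
  valuation_le_of_lt_one : ∀ x, O.valuation x < 1 → O.valuation x ≤ O.valuation (1 - q ^ n)

lemma dvd_add_mul_iff_modEq {d m : ℕ} (hdm : d.Coprime m) {a : ℤ} {t : ℕ}
    (ht : (m : ℤ) ∣ a + d * t) (j : ℕ) : (m : ℤ) ∣ a + d * j ↔ j ≡ t [MOD m] := by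
  rw [Nat.modEq_iff_dvd, show a + d * (j : ℤ) = (a + d * t) - d * (t - j) by ring,
    dvd_sub_right ht]
  exact ⟨(Nat.isCoprime_iff_coprime.2 hdm.symm).dvd_of_dvd_mul_left, fun h => h.mul_left _⟩

lemma qPoch_zpow {F : Type*} [Field F] {q : F} (hq : q ≠ 0) (a : ℤ) (d k : ℕ) :
    qPoch (q ^ a) (q ^ d) k = ∏ j ∈ Finset.range k, (1 - q ^ (a + d * j)) :=
  Finset.prod_congr rfl fun j _ => by rw [zpow_add₀ hq, zpow_mul, zpow_natCast, zpow_natCast]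

namespace IsCyclotomicPlace

variable {F : Type*} [Field F] {O : ValuationSubring F} {q : F} {ζ : ResidueField O} {d m n : ℕ}

lemma order_pos (h : IsCyclotomicPlace O q ζ m n) : 0 < m := by
  rcases Nat.eq_zero_or_pos m with rfl | hm
  · exact absurd (by rw [zero_dvd_iff.1 h.dvd, pow_zero]) h.pow_ne_one
  · exact hm

lemma root_ne_zero (h : IsCyclotomicPlace O q ζ m n) : ζ ≠ 0 :=
  h.isPrimitiveRoot.ne_zero h.order_pos.ne'

lemma root_pow_eq_one (h : IsCyclotomicPlace O q ζ m n) : ζ ^ n = 1 :=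
  (h.isPrimitiveRoot.pow_eq_one_iff_dvd n).2 h.dvd

lemma ne_zero (h : IsCyclotomicPlace O q ζ m n) : q ≠ 0 :=
  h.hasResidue.ne_zero h.root_ne_zero

lemma hasResidue_zpow (h : IsCyclotomicPlace O q ζ m n) (a : ℤ) : HasResidue O (q ^ a) (ζ ^ a) :=
  h.hasResidue.zpow h.root_ne_zero a

lemma valuation_zpow (h : IsCyclotomicPlace O q ζ m n) (a : ℤ) : O.valuation (q ^ a) = 1 :=
  (h.hasResidue_zpow a).valuation_eq_one (zpow_ne_zero a h.root_ne_zero)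

lemma valuation_one_sub_pow_lt_one (h : IsCyclotomicPlace O q ζ m n) :
    O.valuation (1 - q ^ n) < 1 := by
  have hres := HasResidue.one.sub (h.hasResidue.pow n)
  rw [h.root_pow_eq_one, sub_self] at hres
  exact hres.valuation_lt_one

lemma valuation_le_of_hasResidue_zero (h : IsCyclotomicPlace O q ζ m n) {x : F}
    (hx : HasResidue O x 0) : O.valuation x ≤ O.valuation (1 - q ^ n) :=
  h.valuation_le_of_lt_one x hx.valuation_lt_one

lemma one_sub_pow_ne_zero (h : IsCyclotomicPlace O q ζ m n) : 1 - q ^ n ≠ 0 :=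
  sub_ne_zero.2 h.pow_ne_one.symm

lemma valuation_one_sub_zpow_of_not_dvd (h : IsCyclotomicPlace O q ζ m n) {a : ℤ}
    (ha : ¬(m : ℤ) ∣ a) : O.valuation (1 - q ^ a) = 1 :=
  (HasResidue.one.sub (h.hasResidue_zpow a)).valuation_eq_one fun hζ =>
    ha ((h.isPrimitiveRoot.zpow_eq_one_iff_dvd a).1 (sub_eq_zero.1 hζ).symm)

variable [CharZero (ResidueField O)]

lemma valuation_one_sub_zpow_of_dvd (h : IsCyclotomicPlace O q ζ m n)
    {a : ℤ} (ha : (m : ℤ) ∣ a) (ha0 : a ≠ 0) :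
    O.valuation (1 - q ^ a) = O.valuation (1 - q ^ n) := by
  have hres : HasResidue O (q ^ m) 1 := h.isPrimitiveRoot.pow_eq_one ▸ h.hasResidue.pow m
  have hne : q ^ m ≠ 1 := fun hq => h.pow_ne_one <| by
    obtain ⟨b, rfl⟩ := h.dvd
    rw [pow_mul, hq, one_pow]
  have key (b : ℤ) (hb : b ≠ 0) : O.valuation (1 - q ^ (m * b)) = O.valuation (1 - q ^ m) := by
    have hdiv := (hres.one_sub_zpow_div hne b).valuation_eq_one (Int.cast_ne_zero.2 hb)
    rw [map_div₀, div_eq_one_iff_eq] at hdiv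
    · rw [zpow_mul, zpow_natCast, hdiv]
    · exact (Valuation.ne_zero_iff _).2 (sub_ne_zero.2 hne.symm)
  obtain ⟨b, rfl⟩ := ha
  obtain ⟨l, hl⟩ := h.dvd
  rw [key b (right_ne_zero_of_mul ha0), ← zpow_natCast q n, hl, Nat.cast_mul, key]
  rintro hl0
  exact h.pow_ne_one (by rw [hl, Nat.cast_eq_zero.1 hl0, mul_zero, pow_zero])

lemma valuation_one_sub_pow_le (h : IsCyclotomicPlace O q ζ m n)
    {a : ℤ} (ha : a ≠ 0) : O.valuation (1 - q ^ n) ≤ O.valuation (1 - q ^ a) := by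
  by_cases hdvd : (m : ℤ) ∣ a
  · exact (h.valuation_one_sub_zpow_of_dvd hdvd ha).ge
  · exact (h.valuation_one_sub_zpow_of_not_dvd hdvd).symm ▸ h.valuation_one_sub_pow_lt_one.le

lemma one_sub_zpow_ne_zero (h : IsCyclotomicPlace O q ζ m n)
    {a : ℤ} (ha : a ≠ 0) : 1 - q ^ a ≠ 0 := fun h0 =>
  (Valuation.ne_zero_iff O.valuation).2 h.one_sub_pow_ne_zero
    (le_zero_iff.1 (by simpa only [h0, map_zero] using h.valuation_one_sub_pow_le ha))

lemma valuation_qPoch (h : IsCyclotomicPlace O q ζ m n) (hdm : d.Coprime m) {a : ℤ} {t : ℕ}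
    (ht : (m : ℤ) ∣ a + d * t) {k : ℕ} (ha : ∀ j < k, a + d * j ≠ 0) :
    O.valuation (qPoch (q ^ a) (q ^ d) k) =
      O.valuation (1 - q ^ n) ^ (k / m + if t % m < k % m then 1 else 0) := by
  rw [qPoch_zpow h.ne_zero, map_prod, ← Nat.count_modEq_card k h.order_pos t,
    Nat.count_eq_card_filter_range, ← Finset.prod_const, Finset.prod_filter]
  refine Finset.prod_congr rfl fun j hj => ?_
  split_ifs with hjt
  · exact h.valuation_one_sub_zpow_of_dvd ((dvd_add_mul_iff_modEq hdm ht j).2 hjt)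
      (ha j (Finset.mem_range.1 hj))
  · exact h.valuation_one_sub_zpow_of_not_dvd (mt (dvd_add_mul_iff_modEq hdm ht j).1 hjt)

lemma valuation_qPoch_le (h : IsCyclotomicPlace O q ζ m n) (hdm : d.Coprime m) {a : ℤ} {t : ℕ}
    (ht : (m : ℤ) ∣ a + d * t) (k : ℕ) :
    O.valuation (qPoch (q ^ a) (q ^ d) k) ≤
      O.valuation (1 - q ^ n) ^ (k / m + if t % m < k % m then 1 else 0) := by
  by_cases ha : ∀ j < k, a + d * j ≠ 0
  · exact (h.valuation_qPoch hdm ht ha).le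
  · push Not at ha
    obtain ⟨j, hj, hj0⟩ := ha
    rw [qPoch_zpow h.ne_zero, Finset.prod_eq_zero (Finset.mem_range.2 hj) (by simp [hj0]), map_zero]
    exact zero_le

lemma valuation_qPoch_self (h : IsCyclotomicPlace O q ζ m n) (hdm : d.Coprime m) (hd : d ≠ 0)
    (k : ℕ) : O.valuation (qPoch (q ^ d) (q ^ d) k) = O.valuation (1 - q ^ n) ^ (k / m) := by
  have hm := h.order_pos
  have ht : (m : ℤ) ∣ (d : ℤ) + d * (m - 1 : ℕ) :=
    ⟨d, by push_cast [Nat.cast_sub hm]; ring⟩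
  have hlt : ¬(m - 1) % m < k % m := by
    have := Nat.mod_lt k hm
    rw [Nat.mod_eq_of_lt (Nat.sub_lt hm one_pos)]
    omega
  simpa only [zpow_natCast, if_neg hlt, add_zero] using
    h.valuation_qPoch hdm ht (k := k) fun j _ => by positivity

end IsCyclotomicPlace

end CyclotomicPlace

section Antisymmetry

variable {F : Type*} [Field F]

lemma qPoch_mul_inv_pow_add {p a : F} (hp : p ≠ 0) (ha : a ≠ 0) (i j : ℕ) :
    qPoch (a * (p ^ (i + j))⁻¹) p j * (p ^ (i + 1) / a) ^ j * qPoch (p / a) p i =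
      qPoch (p / a) p (i + j) * ∏ l ∈ Finset.range j, (-(p ^ l)⁻¹) := by
  have h := qPoch_reflect hp (a := p / a * p ^ i)
    (mul_ne_zero (div_ne_zero hp ha) (pow_ne_zero i hp)) j
  rw [show p / (p / a * p ^ i * p ^ j) = a * (p ^ (i + j))⁻¹ by rw [pow_add]; field_simp,
    show p / a * p ^ i = p ^ (i + 1) / a by ring] at h
  rw [h, qPoch_add, show p / a * p ^ i = p ^ (i + 1) / a by ring]
  ring

lemma prod_neg_inv_pow_pow_six {p : F} (hp : p ≠ 0) (j : ℕ) :
    (∏ l ∈ Finset.range j, (-(p ^ l)⁻¹)) ^ 6 = p ^ (3 * j) / p ^ (3 * j ^ 2) := by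
  induction j with
  | zero => simp
  | succ j ih =>
    rw [Finset.prod_range_succ, mul_pow, ih,
      show 3 * (j + 1) ^ 2 = 3 * j ^ 2 + 6 * j + 3 by ring, show 3 * (j + 1) = 3 * j + 3 by ring]
    simp only [pow_add, pow_mul' p 6 j]
    field_simp

/-- The terms of a terminating very-well-poised series, with all parameters equal to `p ^ (-t)`
but one that equals `c p ^ (-t)`. -/
def wpSymmTerm (p c : F) (t k : ℕ) : F :=
  (1 - (p ^ k) ^ 2 * (p ^ t)⁻¹) *
    (qPoch (p ^ t)⁻¹ p k ^ 5 * qPoch (c * (p ^ t)⁻¹) p k / (qPoch p p k ^ 5 * qPoch (p / c) p k)) *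
    (p ^ 2 * (p ^ t) ^ 3 / c) ^ k

lemma wpSymmTerm_eq {p c : F} (hp : p ≠ 0) (hc : c ≠ 0) (i j : ℕ)
    (h1 : qPoch p p (i + j) ≠ 0) (h2 : qPoch (p / c) p (i + j) ≠ 0) :
    wpSymmTerm p c (i + j) j = ((p ^ j)⁻¹ - (p ^ i)⁻¹) * (p ^ (3 * (i * j)))⁻¹ *
      ((qPoch p p (i + j) / (qPoch p p i * qPoch p p j)) ^ 5 *
        (qPoch (p / c) p (i + j) / (qPoch (p / c) p i * qPoch (p / c) p j))) := by
  have r1 := qPoch_mul_inv_pow_add hp one_ne_zero i j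
  have r2 := qPoch_mul_inv_pow_add hp hc i j
  have hS := prod_neg_inv_pow_pow_six hp j
  rw [one_mul, div_one, div_one] at r1
  rw [← eq_div_iff (qPoch_ne_zero_of_le h1 (Nat.le_add_right i j)),
    ← eq_div_iff (pow_ne_zero j (pow_ne_zero (i + 1) hp))] at r1
  rw [← eq_div_iff (qPoch_ne_zero_of_le h2 (Nat.le_add_right i j)),
    ← eq_div_iff (pow_ne_zero j (div_ne_zero (pow_ne_zero (i + 1) hp) hc))] at r2
  have hweight : (p ^ 2 * (p ^ (i + j)) ^ 3 / c) ^ j * (p ^ (3 * j) / p ^ (3 * j ^ 2)) =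
      ((p ^ (i + 1)) ^ j) ^ 5 * (p ^ (i + 1) / c) ^ j * ((p ^ j)⁻¹ * (p ^ (3 * (i * j)))⁻¹) := by
    simp only [div_pow, mul_pow]
    field_simp
    ring
  have hlin : (p ^ j)⁻¹ - (p ^ i)⁻¹ = (1 - (p ^ j) ^ 2 * (p ^ (i + j))⁻¹) * (p ^ j)⁻¹ := by
    rw [pow_add]; field_simp
  rw [wpSymmTerm, r1, r2, hlin]
  rw [← hS] at hweight
  have huv : ((p ^ (i + 1)) ^ j) ^ 5 * (p ^ (i + 1) / c) ^ j ≠ 0 := by positivity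
  rw [mul_comm _ (_⁻¹ * _), ← div_eq_iff huv] at hweight
  rw [mul_assoc _ (p ^ j)⁻¹, ← hweight]
  ring

lemma wpSymmTerm_antisymm {p c : F} (hp : p ≠ 0) (hc : c ≠ 0) (i j : ℕ)
    (h1 : qPoch p p (i + j) ≠ 0) (h2 : qPoch (p / c) p (i + j) ≠ 0) :
    wpSymmTerm p c (i + j) i = -wpSymmTerm p c (i + j) j := by
  rw [wpSymmTerm_eq hp hc i j h1 h2]
  rw [add_comm i j] at h1 h2 ⊢
  rw [wpSymmTerm_eq hp hc j i h1 h2, mul_comm j i]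
  ring

lemma sum_range_eq_zero_of_antisymm [CharZero F] {t : ℕ} {f : ℕ → F}
    (h : ∀ i j, i + j = t → f i = -f j) : ∑ k ∈ Finset.range (t + 1), f k = 0 := by
  rw [← self_eq_neg, ← Finset.sum_neg_distrib, ← Finset.sum_range_reflect]
  refine Finset.sum_congr rfl fun j hj => h _ _ ?_
  have := Finset.mem_range.1 hj
  omega

/-- The factor of the summand of `lhsSum` other than the `q`-integer. -/
def lhsFactor (q c : F) (d : ℕ) (r : ℤ) (k : ℕ) : F :=
  qPoch (q ^ r) (q ^ d) k ^ 5 * qPoch (c * q ^ r) (q ^ d) k /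
      (qPoch (q ^ d) (q ^ d) k ^ 5 * qPoch (q ^ d / c) (q ^ d) k) *
    (q ^ (2 * (d : ℤ) - 3 * r) / c) ^ k

/-- The summand of `lhsSum`. -/
def lhsTerm (q c : F) (d : ℕ) (r : ℤ) (k : ℕ) : F :=
  qInt q (2 * d * k + r) * lhsFactor q c d r k

lemma lhsSum_eq_sum_lhsTerm (q c : F) (d : ℕ) (r : ℤ) (M : ℕ) :
    lhsSum q c d r M = ∑ k ∈ Finset.range (M + 1), lhsTerm q c d r k :=
  Finset.sum_congr rfl fun _ _ => mul_assoc _ _ _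

lemma lhsTerm_eq_wpSymmTerm {q : F} (hq : q ≠ 0) (c : F) {d t : ℕ} {r : ℤ}
    (hr : q ^ r = ((q ^ d) ^ t)⁻¹) (k : ℕ) :
    lhsTerm q c d r k = wpSymmTerm (q ^ d) c t k / (1 - q) := by
  have hint : q ^ (2 * (d : ℤ) * k + r) = ((q ^ d) ^ k) ^ 2 * ((q ^ d) ^ t)⁻¹ := by
    rw [zpow_add₀ hq, hr, mul_assoc, zpow_mul', zpow_ofNat, zpow_mul, zpow_natCast, zpow_natCast]
  have harg : q ^ (2 * (d : ℤ) - 3 * r) = (q ^ d) ^ 2 * ((q ^ d) ^ t) ^ 3 := by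
    rw [zpow_sub₀ hq, zpow_mul', zpow_mul', hr, zpow_ofNat, zpow_ofNat, zpow_natCast, inv_pow,
      div_inv_eq_mul]
  rw [lhsTerm, qInt, lhsFactor, wpSymmTerm, hint, harg, hr]
  ring

lemma lhsTerm_antisymm {q c : F} (hq : q ≠ 0) (hc : c ≠ 0) {d t : ℕ} {r : ℤ}
    (hr : q ^ r = ((q ^ d) ^ t)⁻¹) (h1 : qPoch (q ^ d) (q ^ d) t ≠ 0)
    (h2 : qPoch (q ^ d / c) (q ^ d) t ≠ 0) {i j : ℕ} (hij : i + j = t) :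
    lhsTerm q c d r i = -lhsTerm q c d r j := by
  subst hij
  rw [lhsTerm_eq_wpSymmTerm hq c hr, lhsTerm_eq_wpSymmTerm hq c hr,
    wpSymmTerm_antisymm (pow_ne_zero d hq) hc i j h1 h2, neg_div]

lemma lhsFactor_add (q c : F) (d : ℕ) (r : ℤ) (k j : ℕ) :
    lhsFactor q c d r (k + j) = lhsFactor q c d r k *
      (qPoch (q ^ r * (q ^ d) ^ k) (q ^ d) j ^ 5 * qPoch (c * q ^ r * (q ^ d) ^ k) (q ^ d) j /
        (qPoch (q ^ d * (q ^ d) ^ k) (q ^ d) j ^ 5 * qPoch (q ^ d / c * (q ^ d) ^ k) (q ^ d) j) *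
      (q ^ (2 * (d : ℤ) - 3 * r) / c) ^ j) := by
  simp only [lhsFactor, qPoch_add]
  ring

lemma sum_range_mul_add (f : ℕ → F) (m s J : ℕ) :
    ∑ k ∈ Finset.range (s * m + J), f k =
      ∑ l ∈ Finset.range s, ∑ j ∈ Finset.range m, f (l * m + j) +
        ∑ j ∈ Finset.range J, f (s * m + j) := by
  rw [Finset.sum_range_add]
  congr 1
  induction s with
  | zero => simp
  | succ s ih => rw [Nat.succ_mul, Finset.sum_range_add, ih, Finset.sum_range_succ]

end Antisymmetry

section NontrivialRoots

open IsLocalRing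

/-- The parameter `c` reduces to a nonzero residue `γ`, and `c = 1` as soon as `γ` is an `n`-th root
of unity. -/
structure IsGenericParameter {F : Type*} [Field F] (O : ValuationSubring F) (c : F)
    (γ : ResidueField O) (n : ℕ) : Prop where
  hasResidue : HasResidue O c γ
  ne_zero : γ ≠ 0
  eq_one_of_pow_eq_one : γ ^ n = 1 → c = 1

variable {F : Type*} [Field F] {O : ValuationSubring F} {q c : F} {ζ γ : ResidueField O}
  {d m n N : ℕ} {r : ℤ}

namespace IsCyclotomicPlace

lemma qPoch_root_ne_zero (h : IsCyclotomicPlace O q ζ m n) (hdm : d.Coprime m) {j : ℕ}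
    (hj : j < m) : qPoch (ζ ^ d) (ζ ^ d) j ≠ 0 := by
  refine qPoch_ne_zero_iff.2 fun i hi h0 => ?_
  rw [← pow_succ'] at h0
  have hdvd := ((h.isPrimitiveRoot.pow_of_coprime d hdm).pow_eq_one_iff_dvd _).1
    (sub_eq_zero.1 h0).symm
  have := Nat.le_of_dvd i.succ_pos hdvd
  omega

lemma qPoch_root_div_ne_zero_of_ne_one (h : IsCyclotomicPlace O q ζ m n)
    (hc : IsGenericParameter O c γ n) (hc1 : c ≠ 1) (k : ℕ) :
    qPoch (ζ ^ d / γ) (ζ ^ d) k ≠ 0 := by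
  refine qPoch_ne_zero_iff.2 fun i _ h0 => hc1 (hc.eq_one_of_pow_eq_one ?_)
  rw [sub_eq_zero, eq_comm, div_mul_eq_mul_div, div_eq_iff hc.ne_zero, one_mul, ← pow_succ',
    ← pow_mul] at h0
  rw [← h0, ← pow_mul, mul_comm, pow_mul, h.root_pow_eq_one, one_pow]

lemma residue_eq_one (hc : IsGenericParameter O (1 : F) γ n) : γ = 1 :=
  hc.hasResidue.unique .one

lemma qPoch_root_div_ne_zero (h : IsCyclotomicPlace O q ζ m n) (hdm : d.Coprime m)
    (hc : IsGenericParameter O c γ n) {j : ℕ} (hj : j < m) : qPoch (ζ ^ d / γ) (ζ ^ d) j ≠ 0 := by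
  by_cases hc1 : c = 1
  · subst hc1
    rw [residue_eq_one hc, div_one]
    exact h.qPoch_root_ne_zero hdm hj
  · exact h.qPoch_root_div_ne_zero_of_ne_one hc hc1 j

lemma hasResidue_qPoch_mul (h : IsCyclotomicPlace O q ζ m n) (hc : HasResidue O c γ) (d : ℕ)
    (a : ℤ) (k : ℕ) : HasResidue O (qPoch (c * q ^ a) (q ^ d) k)
      (qPoch (γ * ζ ^ a) (ζ ^ d) k) :=
  (hc.mul (h.hasResidue_zpow a)).qPoch (h.hasResidue.pow d) k

lemma valuation_qPoch_div_of_ne_one (h : IsCyclotomicPlace O q ζ m n)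
    (hc : IsGenericParameter O c γ n) (hc1 : c ≠ 1) (k : ℕ) :
    O.valuation (qPoch (q ^ d / c) (q ^ d) k) = 1 :=
  (((h.hasResidue.pow d).div hc.hasResidue hc.ne_zero).qPoch
    (h.hasResidue.pow d) k).valuation_eq_one (h.qPoch_root_div_ne_zero_of_ne_one hc hc1 k)

lemma root_zpow_eq (h : IsCyclotomicPlace O q ζ m n) (hr : r + d * N = n) :
    ζ ^ r = ((ζ ^ d) ^ (N % m))⁻¹ := by
  have hζd : (ζ ^ d) ^ m = 1 := by rw [pow_right_comm, h.isPrimitiveRoot.pow_eq_one, one_pow]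
  apply eq_inv_of_mul_eq_one_left
  rw [← pow_eq_pow_mod N hζd, ← pow_mul, ← zpow_natCast ζ (d * N), ← zpow_add₀ h.root_ne_zero,
    Nat.cast_mul, hr, zpow_natCast, h.root_pow_eq_one]

lemma dvd_add_mul (h : IsCyclotomicPlace O q ζ m n) (hr : r + d * N = n) :
    (m : ℤ) ∣ r + d * N := hr ▸ Int.natCast_dvd_natCast.2 h.dvd

lemma lhsFactor_root_eq_zero (h : IsCyclotomicPlace O q ζ m n) (hr : r + d * N = n)
    (γ : ResidueField O) {j : ℕ} (hj : N % m < j) : lhsFactor ζ γ d r j = 0 := by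
  rw [lhsFactor, h.root_zpow_eq hr, qPoch_inv_pow_eq_zero (pow_ne_zero d h.root_ne_zero) hj]
  simp

lemma lhsTerm_root_antisymm (h : IsCyclotomicPlace O q ζ m n) (hdm : d.Coprime m)
    (hr : r + d * N = n) (hc : IsGenericParameter O c γ n) {i j : ℕ} (hij : i + j = N % m) :
    lhsTerm ζ γ d r i = -lhsTerm ζ γ d r j :=
  lhsTerm_antisymm h.root_ne_zero hc.ne_zero (h.root_zpow_eq hr)
    (h.qPoch_root_ne_zero hdm (Nat.mod_lt _ h.order_pos))
    (h.qPoch_root_div_ne_zero hdm hc (Nat.mod_lt _ h.order_pos)) hij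

lemma sum_lhsTerm_root_eq_zero [CharZero (ResidueField O)] (h : IsCyclotomicPlace O q ζ m n)
    (hdm : d.Coprime m) (hr : r + d * N = n) (hc : IsGenericParameter O c γ n) {J : ℕ}
    (hJ : N % m < J) : ∑ j ∈ Finset.range J, lhsTerm ζ γ d r j = 0 := by
  rw [← Finset.sum_subset (Finset.range_subset_range.2 (Nat.succ_le_of_lt hJ))]
  · exact sum_range_eq_zero_of_antisymm fun i j hij => h.lhsTerm_root_antisymm hdm hr hc hij
  · intro j _ hj
    rw [lhsTerm, h.lhsFactor_root_eq_zero hr γ (by simpa using hj), mul_zero]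

lemma root_ne_one (h : IsCyclotomicPlace O q ζ m n) (hm : m ≠ 1) : ζ ≠ 1 := fun hζ =>
  hm (h.isPrimitiveRoot.unique (hζ ▸ IsPrimitiveRoot.one))

lemma qInt_root_add (h : IsCyclotomicPlace O q ζ m n) (a b : ℤ) :
    qInt ζ (m * a + b) = qInt ζ b := by
  rw [qInt, qInt, zpow_add₀ h.root_ne_zero, zpow_mul, zpow_natCast, h.isPrimitiveRoot.pow_eq_one,
    one_zpow, one_mul]

variable [CharZero (ResidueField O)]

lemma valuation_qPoch_div_qPoch_le_one (h : IsCyclotomicPlace O q ζ m n) (hdm : d.Coprime m)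
    (hd : d ≠ 0) {a : ℤ} {t : ℕ} (ht : (m : ℤ) ∣ a + d * t) (k : ℕ) :
    O.valuation (qPoch (q ^ a) (q ^ d) k / qPoch (q ^ d) (q ^ d) k) ≤ 1 := by
  have hω : O.valuation (1 - q ^ n) ^ (k / m) ≠ 0 :=
    pow_ne_zero _ ((Valuation.ne_zero_iff _).2 h.one_sub_pow_ne_zero)
  rw [map_div₀, h.valuation_qPoch_self hdm hd, div_le_one₀ (zero_lt_iff.2 hω)]
  exact (h.valuation_qPoch_le hdm ht k).trans
    (pow_le_pow_right_of_le_one' h.valuation_one_sub_pow_lt_one.le (Nat.le_add_right _ _))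

lemma valuation_qPoch_mul_div_qPoch_div_le_one (h : IsCyclotomicPlace O q ζ m n)
    (hdm : d.Coprime m) (hd : d ≠ 0) (hc : IsGenericParameter O c γ n) {a : ℤ} {t : ℕ}
    (ht : (m : ℤ) ∣ a + d * t) (k : ℕ) :
    O.valuation (qPoch (c * q ^ a) (q ^ d) k / qPoch (q ^ d / c) (q ^ d) k) ≤ 1 := by
  by_cases hc1 : c = 1
  · rw [hc1, one_mul, div_one]
    exact h.valuation_qPoch_div_qPoch_le_one hdm hd ht k
  · rw [map_div₀, h.valuation_qPoch_div_of_ne_one hc hc1, div_one]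
    exact (h.hasResidue_qPoch_mul hc.hasResidue d a k).valuation_le_one

lemma valuation_lhsFactor_le_one (h : IsCyclotomicPlace O q ζ m n) (hdm : d.Coprime m)
    (hd : d ≠ 0) (hr : r + d * N = n) (hc : IsGenericParameter O c γ n) (k : ℕ) :
    O.valuation (lhsFactor q c d r k) ≤ 1 := by
  have hqPoch := h.valuation_qPoch_div_qPoch_le_one hdm hd (h.dvd_add_mul hr) k
  have hqPochc := h.valuation_qPoch_mul_div_qPoch_div_le_one hdm hd hc (h.dvd_add_mul hr) k
  have harg := ((h.hasResidue_zpow (2 * (d : ℤ) - 3 * r)).div hc.hasResidue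
    hc.ne_zero).valuation_le_one
  rw [lhsFactor, mul_div_mul_comm, ← div_pow, map_mul, map_mul, map_pow, map_pow]
  exact mul_le_one' (mul_le_one' (pow_le_one' hqPoch 5) hqPochc) (pow_le_one' harg k)

lemma exists_hasResidue_lhsFactor_add (h : IsCyclotomicPlace O q ζ m n) (hdm : d.Coprime m)
    (hd : d ≠ 0) (hr : r + d * N = n) (hc : IsGenericParameter O c γ n) (l : ℕ) :
    ∃ σ, ∀ j < m, HasResidue O (lhsFactor q c d r (l * m + j)) (σ * lhsFactor ζ γ d r j) := by
  obtain ⟨σ, hσ⟩ := exists_hasResidue (h.valuation_lhsFactor_le_one hdm hd hr hc (l * m))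
  refine ⟨σ, fun j hj => ?_⟩
  have hq := h.hasResidue.pow d
  have hshift : HasResidue O ((q ^ d) ^ (l * m)) 1 := by
    have hζ : (ζ ^ d) ^ (l * m) = 1 := by
      rw [← pow_mul, ← mul_assoc, pow_mul', h.isPrimitiveRoot.pow_eq_one, one_pow]
    exact hζ ▸ hq.pow (l * m)
  have hqPoch {x : F} {y : ResidueField O} (hx : HasResidue O x y) :
      HasResidue O (qPoch (x * (q ^ d) ^ (l * m)) (q ^ d) j) (qPoch y (ζ ^ d) j) := by
    simpa only [mul_one] using (hx.mul hshift).qPoch hq j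
  rw [lhsFactor_add]
  exact hσ.mul (((((hqPoch (h.hasResidue_zpow r)).pow 5).mul
    (hqPoch (hc.hasResidue.mul (h.hasResidue_zpow r)))).div
    (((hqPoch hq).pow 5).mul (hqPoch (hq.div hc.hasResidue hc.ne_zero)))
    (mul_ne_zero (pow_ne_zero 5 (h.qPoch_root_ne_zero hdm hj))
      (h.qPoch_root_div_ne_zero hdm hc hj))).mul
    (((h.hasResidue_zpow _).div hc.hasResidue hc.ne_zero).pow j))

/-- Modulo the place, the summands of a block of `m` consecutive indices are proportional to the
first ones at `ζ`, whose sum vanishes by antisymmetry. -/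
lemma valuation_sum_lhsTerm_block_le (h : IsCyclotomicPlace O q ζ m n) (hm : m ≠ 1)
    (hdm : d.Coprime m) (hd : d ≠ 0) (hr : r + d * N = n) (hc : IsGenericParameter O c γ n)
    (l : ℕ) {J : ℕ} (hJ : N % m < J) (hJm : J ≤ m) :
    O.valuation (∑ j ∈ Finset.range J, lhsTerm q c d r (l * m + j)) ≤
      O.valuation (1 - q ^ n) := by
  obtain ⟨σ, hσ⟩ := h.exists_hasResidue_lhsFactor_add hdm hd hr hc l
  have hterm : ∀ j ∈ Finset.range J,
      HasResidue O (lhsTerm q c d r (l * m + j)) (σ * lhsTerm ζ γ d r j) := by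
    intro j hj
    have hint : HasResidue O (qInt q (2 * d * (l * m + j : ℕ) + r)) (qInt ζ (2 * d * j + r)) := by
      rw [← h.qInt_root_add (2 * d * l), show (m : ℤ) * (2 * d * l) + (2 * d * j + r) =
        2 * d * (l * m + j : ℕ) + r by push_cast; ring]
      exact h.hasResidue.qInt h.root_ne_zero (h.root_ne_one hm) _
    rw [lhsTerm, lhsTerm, mul_left_comm]
    exact hint.mul (hσ j ((Finset.mem_range.1 hj).trans_le hJm))
  apply h.valuation_le_of_hasResidue_zero
  simpa only [← Finset.mul_sum, h.sum_lhsTerm_root_eq_zero hdm hr hc hJ, mul_zero] using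
    HasResidue.sum hterm

lemma valuation_lhsSum_le (h : IsCyclotomicPlace O q ζ m n) (hm : m ≠ 1) (hdm : d.Coprime m)
    (hd : d ≠ 0) (hr : r + d * N = n) (hc : IsGenericParameter O c γ n) {M : ℕ}
    (hM : M = N ∨ M = n - 1) : O.valuation (lhsSum q c d r M) ≤ O.valuation (1 - q ^ n) := by
  have hblock (l : ℕ) {J : ℕ} (hJ : N % m < J) (hJm : J ≤ m) :=
    h.valuation_sum_lhsTerm_block_le hm hdm hd hr hc l hJ hJm
  have hlt : N % m < m := Nat.mod_lt N h.order_pos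
  obtain ⟨s, J, hMJ, hJ⟩ : ∃ s J, M + 1 = s * m + J ∧ (J = 0 ∨ N % m < J ∧ J ≤ m) := by
    rcases hM with rfl | rfl
    · exact ⟨M / m, M % m + 1, by rw [← add_assoc, Nat.div_add_mod'], by omega⟩
    · have hn : n ≠ 0 := fun h0 => h.pow_ne_one (by rw [h0, pow_zero])
      exact ⟨n / m, 0, by rw [Nat.div_mul_cancel h.dvd]; omega, Or.inl rfl⟩
  rw [lhsSum_eq_sum_lhsTerm, hMJ, sum_range_mul_add]
  refine Valuation.map_add_le _ (Valuation.map_sum_le _ fun l _ => hblock l hlt le_rfl) ?_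
  rcases hJ with rfl | ⟨hJ, hJm⟩
  · simp
  · exact hblock s hJ hJm

end IsCyclotomicPlace

end NontrivialRoots

section RightSide

open IsLocalRing

/-- The coefficient of index `k` in `rhsSum`, including the prefactor of the sum but without the
harmonic correction. -/
def rhsCoeff {F : Type*} [Field F] (q c : F) (n d : ℕ) (r : ℤ) (N k : ℕ) : F :=
  qInt q n * (c * q ^ r) ^ ((r - n) / (d : ℤ)) *
    (qPoch (c * q ^ (2 * r)) (q ^ d) N / qPoch (q ^ d / c) (q ^ d) N) *
    (qPoch (q ^ r) (q ^ d) k ^ 2 *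
          (qPoch (q ^ ((d : ℤ) - r)) (q ^ d) k * qPoch (c * q ^ r) (q ^ d) k) * q ^ (d * k) /
        (qPoch (q ^ d) (q ^ d) k ^ 3 * qPoch (c * q ^ (2 * r)) (q ^ d) k))

variable {F : Type*} [Field F]

lemma rhsSum_eq_sum_rhsCoeff (q c : F) (n d : ℕ) (r : ℤ) (N : ℕ) :
    rhsSum q c n d r N = ∑ k ∈ Finset.range (N + 1), rhsCoeff q c n d r N k *
      (1 - qInt q n ^ 2 * (2 - q ^ n) * harmSum q d r k) := by
  rw [rhsSum, Finset.mul_sum]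
  exact Finset.sum_congr rfl fun _ _ => (mul_assoc _ _ _).symm

lemma rhsCoeff_eq {q c : F} (hq : q ≠ 0) {n d N k : ℕ} {r : ℤ} (hk : k ≤ N)
    (hden : qPoch (c * q ^ (2 * r)) (q ^ d) N ≠ 0) :
    rhsCoeff q c n d r N k = qInt q n * ((c * q ^ r) ^ ((r - n) / (d : ℤ)) * q ^ (d * k)) *
      (qPoch (q ^ r) (q ^ d) k / qPoch (q ^ d) (q ^ d) k) ^ 2 *
      (qPoch (q ^ ((d : ℤ) - r)) (q ^ d) k / qPoch (q ^ d) (q ^ d) k) *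
      (qPoch (c * q ^ r) (q ^ d) k * qPoch (c * q ^ (2 * r + d * k)) (q ^ d) (N - k) /
        qPoch (q ^ d / c) (q ^ d) N) := by
  have hsplit : qPoch (c * q ^ (2 * r)) (q ^ d) N = qPoch (c * q ^ (2 * r)) (q ^ d) k *
      qPoch (c * q ^ (2 * r + d * k)) (q ^ d) (N - k) := by
    rw [zpow_add₀ hq, zpow_mul q d, zpow_natCast, zpow_natCast, ← mul_assoc, ← qPoch_add,
      Nat.add_sub_cancel' hk]
  have hdenk := qPoch_ne_zero_of_le hden hk
  rw [rhsCoeff, hsplit]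
  field_simp

lemma div_le_ite_add_div_add_div {m N k : ℕ} (hm : 0 < m) (hk : k ≤ N) :
    N / m ≤ (if N % m < k % m then 1 else 0) + k / m + (N - k) / m := by
  obtain ⟨l, rfl⟩ := Nat.exists_eq_add_of_le hk
  rw [Nat.add_sub_cancel_left, Nat.add_div hm]
  have hk' := Nat.mod_lt k hm
  have hl' := Nat.mod_lt l hm
  split_ifs with hcarry hlt
  · omega
  · rw [Nat.add_mod, Nat.mod_eq_sub_mod hcarry, Nat.mod_eq_of_lt (by omega)] at hlt
    omega
  all_goals omega

variable {O : ValuationSubring F} {q c : F} {ζ γ : ResidueField O} {d m n N k : ℕ} {r : ℤ}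

namespace IsCyclotomicPlace

lemma valuation_qInt_le (h : IsCyclotomicPlace O q ζ m n) (hm : m ≠ 1) :
    O.valuation (qInt q n) ≤ O.valuation (1 - q ^ n) := by
  have hres := h.hasResidue.qInt h.root_ne_zero (h.root_ne_one hm) n
  rw [show qInt ζ n = 0 by simp [qInt, h.root_pow_eq_one]] at hres
  exact h.valuation_le_of_hasResidue_zero hres

variable [CharZero (ResidueField O)]

lemma valuation_qPoch_mul_qPoch_div_le_one (h : IsCyclotomicPlace O q ζ m n) (hdm : d.Coprime m)
    (hd : d ≠ 0) (hr : r + d * N = n) (hc : IsGenericParameter O c γ n) (hk : k ≤ N) :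
    O.valuation (qPoch (c * q ^ r) (q ^ d) k * qPoch (c * q ^ (2 * r + d * k)) (q ^ d) (N - k) /
      qPoch (q ^ d / c) (q ^ d) N) ≤ 1 := by
  by_cases hc1 : c = 1
  · have ht : (m : ℤ) ∣ (2 * r + d * k) + d * (2 * N + (m - 1) * k : ℕ) := by
      obtain ⟨b, hb⟩ := h.dvd_add_mul hr
      refine ⟨2 * b + d * k, ?_⟩
      push_cast [Nat.cast_sub (show 1 ≤ m from h.order_pos)]
      linear_combination 2 * hb
    have hω : 0 < O.valuation (1 - q ^ n) ^ (N / m) :=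
      pow_pos (zero_lt_iff.2 ((Valuation.ne_zero_iff _).2 h.one_sub_pow_ne_zero)) _
    simp only [hc1, one_mul, div_one, map_div₀, map_mul, h.valuation_qPoch_self hdm hd]
    rw [div_le_one₀ hω]
    refine (mul_le_mul' (h.valuation_qPoch_le hdm (h.dvd_add_mul hr) k)
      (h.valuation_qPoch_le hdm ht (N - k))).trans ?_
    rw [← pow_add]
    refine pow_le_pow_right_of_le_one' h.valuation_one_sub_pow_lt_one.le ?_
    have := div_le_ite_add_div_add_div h.order_pos hk
    omega
  · rw [map_div₀, h.valuation_qPoch_div_of_ne_one hc hc1, div_one]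
    exact ((h.hasResidue_qPoch_mul hc.hasResidue d r k).mul
      (h.hasResidue_qPoch_mul hc.hasResidue d _ (N - k))).valuation_le_one

lemma valuation_rhsCoeff_le (h : IsCyclotomicPlace O q ζ m n) (hm : m ≠ 1) (hdm : d.Coprime m)
    (hd : d ≠ 0) (hr : r + d * N = n) (hc : IsGenericParameter O c γ n)
    (hden : qPoch (c * q ^ (2 * r)) (q ^ d) N ≠ 0) (hk : k ≤ N) :
    O.valuation (rhsCoeff q c n d r N k) ≤ O.valuation (1 - q ^ n) := by
  have ht : (m : ℤ) ∣ ((d : ℤ) - r) + d * ((m - 1) * (N + 1) : ℕ) := by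
    obtain ⟨b, hb⟩ := h.dvd_add_mul hr
    refine ⟨d * (N + 1) - b, ?_⟩
    push_cast [Nat.cast_sub (show 1 ≤ m from h.order_pos)]
    linear_combination -hb
  have hprefactor : O.valuation ((c * q ^ r) ^ ((r - n) / (d : ℤ)) * q ^ (d * k)) ≤ 1 :=
    (((hc.hasResidue.mul (h.hasResidue_zpow r)).zpow
      (mul_ne_zero hc.ne_zero (zpow_ne_zero r h.root_ne_zero)) _).mul
        (h.hasResidue.pow (d * k))).valuation_le_one
  simp only [rhsCoeff_eq h.ne_zero hk hden, map_mul _ _ (_ / _), map_mul _ _ (_ ^ 2),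
    map_mul _ (qInt q n), map_pow _ (_ / _)]
  exact mul_le_of_le_of_le_one (mul_le_of_le_of_le_one (mul_le_of_le_of_le_one
    (mul_le_of_le_of_le_one (h.valuation_qInt_le hm) hprefactor)
    (pow_le_one' (h.valuation_qPoch_div_qPoch_le_one hdm hd (h.dvd_add_mul hr) k) 2))
    (h.valuation_qPoch_div_qPoch_le_one hdm hd ht k))
    (h.valuation_qPoch_mul_qPoch_div_le_one hdm hd hr hc hk)

lemma valuation_qInt_sq_mul_zpow_div_le_one (h : IsCyclotomicPlace O q ζ m n) {a : ℤ}
    (ha : a ≠ 0) : O.valuation (qInt q n ^ 2 * (q ^ a / qInt q a ^ 2)) ≤ 1 := by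
  have h1 : 1 - q ≠ 0 := by simpa using h.one_sub_zpow_ne_zero one_ne_zero
  have ha' := h.one_sub_zpow_ne_zero ha
  have hquot : O.valuation ((1 - q ^ n) / (1 - q ^ a)) ≤ 1 := by
    rw [map_div₀, div_le_one₀ (zero_lt_iff.2 ((Valuation.ne_zero_iff _).2 ha'))]
    exact h.valuation_one_sub_pow_le ha
  rw [show qInt q n ^ 2 * (q ^ a / qInt q a ^ 2) = ((1 - q ^ n) / (1 - q ^ a)) ^ 2 * q ^ a by
    rw [qInt, qInt, zpow_natCast]; field_simp, map_mul, map_pow, h.valuation_zpow, mul_one]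
  exact pow_le_one' hquot 2

lemma valuation_qInt_sq_mul_harmSum_le_one (h : IsCyclotomicPlace O q ζ m n) (hd : d ≠ 0)
    (hr0 : ∀ j : ℕ, r + d * j ≠ 0) (k : ℕ) :
    O.valuation (qInt q n ^ 2 * harmSum q d r k) ≤ 1 := by
  rw [harmSum, Finset.mul_sum]
  refine Valuation.map_sum_le _ fun j hj => ?_
  obtain ⟨j, rfl⟩ := Nat.exists_eq_add_of_le' (Finset.mem_Icc.1 hj).1
  rw [mul_add]
  refine Valuation.map_add_le _ ?_ (h.valuation_qInt_sq_mul_zpow_div_le_one ?_)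
  · rw [← zpow_natCast q (d * (j + 1)), Nat.cast_mul]
    exact h.valuation_qInt_sq_mul_zpow_div_le_one (by positivity)
  · convert hr0 j using 1
    push_cast
    ring

lemma valuation_rhsSum_le (h : IsCyclotomicPlace O q ζ m n) (hm : m ≠ 1) (hdm : d.Coprime m)
    (hd : d ≠ 0) (hr : r + d * N = n) (hr0 : ∀ j : ℕ, r + d * j ≠ 0)
    (hc : IsGenericParameter O c γ n) (hden : qPoch (c * q ^ (2 * r)) (q ^ d) N ≠ 0) :
    O.valuation (rhsSum q c n d r N) ≤ O.valuation (1 - q ^ n) := by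
  rw [rhsSum_eq_sum_rhsCoeff]
  refine Valuation.map_sum_le _ fun k hk => ?_
  have hharm := h.valuation_qInt_sq_mul_harmSum_le_one hd hr0 k
  have htwo : O.valuation (2 - q ^ n) ≤ 1 := by
    exact_mod_cast ((HasResidue.natCast 2).sub (h.hasResidue.pow n)).valuation_le_one
  rw [map_mul, mul_right_comm (qInt q n ^ 2)]
  refine mul_le_of_le_of_le_one (h.valuation_rhsCoeff_le hm hdm hd hr hc hden
    (Nat.lt_succ_iff.1 (Finset.mem_range.1 hk))) (Valuation.map_sub_le _ (map_one _).le ?_)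
  rw [map_mul]
  exact mul_le_one' hharm htwo

end IsCyclotomicPlace

end RightSide

section Transformation

variable {F : Type*} [Field F] {p α c T : F} {N : ℕ}

/-- The factor by which `(x; p)_k ^ 2` changes when its two factors are replaced by `(xT; p)_k` and
`(x / T; p)_k`. -/
def shiftFactor (p T x : F) (k : ℕ) : F :=
  ∏ i ∈ Finset.range k, (1 + (2 - T - T⁻¹) * (x * p ^ i / (1 - x * p ^ i) ^ 2))

lemma qPoch_mul_qPoch_div (hT : T ≠ 0) {x : F} {k : ℕ} (hx : qPoch x p k ≠ 0) :
    qPoch (x * T) p k * qPoch (x / T) p k = qPoch x p k ^ 2 * shiftFactor p T x k := by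
  rw [qPoch_ne_zero_iff] at hx
  simp only [qPoch, shiftFactor, ← Finset.prod_mul_distrib, ← Finset.prod_pow]
  refine Finset.prod_congr rfl fun i hi => ?_
  have := hx i (Finset.mem_range.1 hi)
  field_simp
  ring

lemma wpTerm_eq_mul_shiftFactor (hp : p ≠ 0) (hα : α ≠ 0) (hT : α * p ^ N = T) (c : F) {k : ℕ}
    (hαk : qPoch α p k ≠ 0) (hpk : qPoch p p k ≠ 0) :
    wpTerm p α (α * T) (c * α) N 0 k =
      qPoch α p k ^ 3 * qPoch (c * α) p k / (qPoch p p k ^ 3 * qPoch (p / c) p k) *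
        (shiftFactor p T α k / shiftFactor p T p k) * (p / (c * α ^ 2)) ^ k := by
  have hT0 : T ≠ 0 := hT ▸ mul_ne_zero hα (pow_ne_zero N hp)
  have hα' := eq_div_of_mul_eq (pow_ne_zero 2 hαk)
    ((mul_comm _ _).trans (qPoch_mul_qPoch_div hT0 hαk).symm)
  have hp' := eq_div_of_mul_eq (pow_ne_zero 2 hpk)
    ((mul_comm _ _).trans (qPoch_mul_qPoch_div hT0 hpk).symm)
  have hbase : α * p ^ (N + 1) / (α * T * (c * α)) = p / (c * α ^ 2) := by
    rw [pow_succ, ← mul_assoc, hT]; field_simp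
  rw [wpTerm, hbase, show α * p / (α * T) = p / T by field_simp,
    show α * p / (c * α) = p / c by field_simp, show (p ^ N)⁻¹ = α / T by rw [← hT]; field_simp,
    show α * p ^ (N + 1) = p * T by rw [← hT]; ring, hα', hp', qPoch_zero, qPoch_zero]
  field_simp

lemma watson_prefactor_eq (hp : p ≠ 0) (hα : α ≠ 0) (hc : c ≠ 0) (hT : α * p ^ N = T)
    (h : qPoch (p / T) p N ≠ 0) :
    (1 - α) * qPoch (α * p) p N * qPoch (α * p / (α * T * (c * α))) p N /
        (qPoch (α * p / (α * T)) p N * qPoch (α * p / (c * α)) p N) =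
      (1 - T) * (qPoch (c * α ^ 2) p N / qPoch (p / c) p N) / (c * α) ^ N := by
  have hT0 : T ≠ 0 := hT ▸ mul_ne_zero hα (pow_ne_zero N hp)
  have hreflect := qPoch_reflect_mul hp hα (mul_ne_zero hc (pow_ne_zero 2 hα)) N
  rw [hT, show c * α ^ 2 = c * α * α by ring, mul_pow, mul_right_comm _ (α ^ N),
    ← mul_assoc _ _ (α ^ N), mul_right_comm _ (α ^ N),
    mul_left_inj' (pow_ne_zero N hα)] at hreflect
  rw [← qPoch_mul_one_sub, hT, show α * p / (α * T) = p / T by field_simp,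
    show α * p / (c * α) = p / c by field_simp,
    show α * p / (α * T * (c * α)) = p / (c * α * α * p ^ N) by rw [← hT]; field_simp,
    show c * α ^ 2 = c * α * α by ring]
  generalize qPoch (p / (c * α * α * p ^ N)) p N = x, qPoch (c * α * α) p N = y,
    qPoch (p / T) p N = z at *
  field_simp
  linear_combination (T - 1) * (qPoch (p / c) p N)⁻¹ * hreflect

lemma watson_shift (hp : p ≠ 0) (hα : α ≠ 0) (hc : c ≠ 0) (hT : α * p ^ N = T) {l β γ : F}
    (hl : l * β * γ = α * p) (h1 : qPoch p p N ≠ 0) (h2 : qPoch α p N ≠ 0)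
    (h3 : qPoch (p / T) p N ≠ 0) (h4 : qPoch (p / c) p N ≠ 0) (h5 : qPoch (p * T) p N ≠ 0)
    (h6 : qPoch (α * T) p N ≠ 0) (h7 : qPoch (c * α) p N ≠ 0) (h8 : qPoch (l * γ) p N ≠ 0)
    (h9 : qPoch (l * β) p N ≠ 0) (h10 : qPoch (c * α ^ 2) p N ≠ 0) :
    ∑ k ∈ Finset.range (N + 1), (1 - α * (p ^ k) ^ 2) *
        (qPoch α p k ^ 3 * qPoch (c * α) p k / (qPoch p p k ^ 3 * qPoch (p / c) p k) *
          (shiftFactor p T α k / shiftFactor p T p k) * (p / (c * α ^ 2)) ^ k) *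
        (qPoch β p k * qPoch γ p k * l ^ k / (qPoch (l * γ) p k * qPoch (l * β) p k)) =
      (1 - T) * (qPoch (c * α ^ 2) p N / qPoch (p / c) p N) / (c * α) ^ N *
        ∑ j ∈ Finset.range (N + 1), qPoch α p j ^ 2 * shiftFactor p T α j * qPoch (c * α) p j *
          qPoch l p j * p ^ j /
            (qPoch p p j * qPoch (l * γ) p j * qPoch (l * β) p j * qPoch (c * α ^ 2) p j) := by
  have hT0 : T ≠ 0 := hT ▸ mul_ne_zero hα (pow_ne_zero N hp)
  have he : α * T * (c * α) / (α * p ^ N) = c * α ^ 2 := by rw [hT]; field_simp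
  have key := watson hp hα (mul_ne_zero hα hT0) (mul_ne_zero hc hα) N hl h1
    (by rwa [show α * p / (α * T) = p / T by field_simp])
    (by rwa [show α * p / (c * α) = p / c by field_simp])
    (by rwa [show α * p ^ (N + 1) = p * T by rw [← hT]; ring]) h6 h7 h8 h9 (by rwa [he])
  rw [watson_prefactor_eq hp hα hc hT h3, he] at key
  refine (Finset.sum_congr rfl fun k hk => ?_).trans
    (key.trans (congrArg _ (Finset.sum_congr rfl fun j hj => ?_)))
  · have hk' := Finset.mem_range_succ_iff.1 hk
    rw [wpTerm_eq_mul_shiftFactor hp hα hT c (qPoch_ne_zero_of_le h2 hk')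
      (qPoch_ne_zero_of_le h1 hk')]
  · rw [← qPoch_mul_qPoch_div hT0 (qPoch_ne_zero_of_le h2 (Finset.mem_range_succ_iff.1 hj)),
      show (p ^ N)⁻¹ = α / T by rw [← hT]; field_simp]
    ring

end Transformation

section PerturbedTransformation

variable {F : Type*} [Field F] {q : F}

lemma one_sub_mul_lhsTerm (hq : q ≠ 0) (hq1 : q ≠ 1) (c : F) (d : ℕ) (r : ℤ) (k : ℕ) :
    (1 - q) * lhsTerm q c d r k = (1 - q ^ r * ((q ^ d) ^ k) ^ 2) *
      (qPoch (q ^ r) (q ^ d) k ^ 3 * qPoch (c * q ^ r) (q ^ d) k /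
        (qPoch (q ^ d) (q ^ d) k ^ 3 * qPoch (q ^ d / c) (q ^ d) k)) *
      (qPoch (q ^ r) (q ^ d) k ^ 2 / qPoch (q ^ d) (q ^ d) k ^ 2) *
      ((q ^ d / (c * (q ^ r) ^ 2)) ^ k * (q ^ d / q ^ r) ^ k) := by
  have hint : q ^ (2 * (d : ℤ) * k + r) = q ^ r * ((q ^ d) ^ k) ^ 2 := by
    rw [zpow_add₀ hq, mul_assoc, zpow_mul', zpow_ofNat, zpow_mul, zpow_natCast, zpow_natCast,
      mul_comm]
  have harg : q ^ (2 * (d : ℤ) - 3 * r) / c = q ^ d / (c * (q ^ r) ^ 2) * (q ^ d / q ^ r) := by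
    rw [zpow_sub₀ hq, zpow_mul', zpow_mul', zpow_ofNat, zpow_ofNat, zpow_natCast]
    ring
  rw [lhsTerm, lhsFactor, qInt, hint, harg, ← mul_assoc, mul_div_cancel₀ _ (sub_ne_zero.2 hq1.symm),
    mul_pow]
  ring

lemma one_sub_mul_rhsCoeff (hq : q ≠ 0) (hq1 : q ≠ 1) (c : F) {n d N : ℕ} {r : ℤ} (hd : d ≠ 0)
    (hr : r + d * N = n) (k : ℕ) :
    (1 - q) * rhsCoeff q c n d r N k = (1 - q ^ n) *
      (qPoch (c * (q ^ r) ^ 2) (q ^ d) N / qPoch (q ^ d / c) (q ^ d) N) / (c * q ^ r) ^ N *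
      (qPoch (q ^ r) (q ^ d) k ^ 2 *
          (qPoch (q ^ d / q ^ r) (q ^ d) k * qPoch (c * q ^ r) (q ^ d) k) * (q ^ d) ^ k /
        (qPoch (q ^ d) (q ^ d) k * qPoch (c * (q ^ r) ^ 2) (q ^ d) k)) /
      qPoch (q ^ d) (q ^ d) k ^ 2 := by
  have hexp : (r - n) / (d : ℤ) = -N := by
    rw [← hr, sub_add_cancel_left, ← mul_neg]
    exact Int.mul_ediv_cancel_left _ (by exact_mod_cast hd)
  have hqn : (1 - q) * qInt q n = 1 - q ^ n := by
    rw [qInt, mul_div_cancel₀ _ (sub_ne_zero.2 hq1.symm), zpow_natCast]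
  rw [rhsCoeff, hexp, zpow_neg, zpow_natCast, zpow_mul', zpow_ofNat, zpow_sub₀ hq, zpow_natCast,
    pow_mul, ← hqn]
  ring

variable {O : ValuationSubring F} {c : F} {ζ γ : IsLocalRing.ResidueField O} {d n N : ℕ} {r : ℤ}

namespace IsCyclotomicPlace

lemma qPoch_root_zpow_ne_zero (h : IsCyclotomicPlace O q ζ n n) (hdn : d.Coprime n)
    (hr : r + d * N = n) (hN : N < n) : qPoch (ζ ^ r) (ζ ^ d) N ≠ 0 := by
  have hξ := h.isPrimitiveRoot.pow_of_coprime d hdn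
  refine qPoch_ne_zero_iff.2 fun i hi h0 => hi.ne (hξ.pow_inj (hi.trans hN) hN ?_)
  rwa [h.root_zpow_eq hr, Nat.mod_eq_of_lt hN, sub_eq_zero, eq_comm, inv_mul_eq_div,
    div_eq_one_iff_eq (pow_ne_zero N (pow_ne_zero d h.root_ne_zero))] at h0

lemma qPoch_mul_zpow_ne_zero (h : IsCyclotomicPlace O q ζ n n) (hdn : d.Coprime n)
    (hr : r + d * N = n) (hN : N < n) (hc : IsGenericParameter O c γ n) :
    qPoch (c * q ^ r) (q ^ d) N ≠ 0 := by
  refine (h.hasResidue_qPoch_mul hc.hasResidue d r N).ne_zero ?_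
  by_cases hc1 : c = 1
  · subst hc1
    rw [residue_eq_one hc, one_mul]
    exact h.qPoch_root_zpow_ne_zero hdn hr hN
  · refine qPoch_ne_zero_iff.2 fun i _ h0 => hc1 (hc.eq_one_of_pow_eq_one ?_)
    have hroot : (ζ ^ r * (ζ ^ d) ^ i) ^ n = 1 := by
      rw [mul_pow, ← zpow_natCast (ζ ^ r), zpow_comm, zpow_natCast, pow_right_comm _ i n,
        pow_right_comm _ d n, h.root_pow_eq_one, one_zpow, one_pow, one_pow, one_mul]
    calc γ ^ n = (γ * ζ ^ r * (ζ ^ d) ^ i) ^ n := by rw [mul_assoc, mul_pow, hroot, mul_one]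
      _ = 1 := by rw [← sub_eq_zero.1 h0, one_pow]

lemma watson_shift (h : IsCyclotomicPlace O q ζ n n) (hdn : d.Coprime n)
    (hr : r + d * N = n) (hN : N < n) (hc : IsGenericParameter O c γ n)
    (hden : qPoch (c * q ^ (2 * r)) (q ^ d) N ≠ 0) {β β' : F} (hβ : β * β' = (q ^ r) ^ 2)
    (h1 : qPoch (q ^ d / q ^ r * β') (q ^ d) N ≠ 0)
    (h2 : qPoch (q ^ d / q ^ r * β) (q ^ d) N ≠ 0) :
    ∑ k ∈ Finset.range (N + 1), (1 - q ^ r * ((q ^ d) ^ k) ^ 2) *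
        (qPoch (q ^ r) (q ^ d) k ^ 3 * qPoch (c * q ^ r) (q ^ d) k /
            (qPoch (q ^ d) (q ^ d) k ^ 3 * qPoch (q ^ d / c) (q ^ d) k) *
          (shiftFactor (q ^ d) (q ^ n) (q ^ r) k / shiftFactor (q ^ d) (q ^ n) (q ^ d) k) *
          (q ^ d / (c * (q ^ r) ^ 2)) ^ k) *
        (qPoch β (q ^ d) k * qPoch β' (q ^ d) k * (q ^ d / q ^ r) ^ k /
          (qPoch (q ^ d / q ^ r * β') (q ^ d) k * qPoch (q ^ d / q ^ r * β) (q ^ d) k)) =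
      (1 - q ^ n) * (qPoch (c * (q ^ r) ^ 2) (q ^ d) N / qPoch (q ^ d / c) (q ^ d) N) /
          (c * q ^ r) ^ N *
        ∑ k ∈ Finset.range (N + 1), qPoch (q ^ r) (q ^ d) k ^ 2 *
          shiftFactor (q ^ d) (q ^ n) (q ^ r) k * qPoch (c * q ^ r) (q ^ d) k *
          qPoch (q ^ d / q ^ r) (q ^ d) k * (q ^ d) ^ k /
            (qPoch (q ^ d) (q ^ d) k * qPoch (q ^ d / q ^ r * β') (q ^ d) k *
              qPoch (q ^ d / q ^ r * β) (q ^ d) k * qPoch (c * (q ^ r) ^ 2) (q ^ d) k) := by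
  have hq := h.ne_zero
  have hα : q ^ r ≠ 0 := zpow_ne_zero r hq
  have hresT : HasResidue O (q ^ n) 1 := h.root_pow_eq_one ▸ h.hasResidue.pow n
  have hresp := h.hasResidue.pow d
  have hresα := h.hasResidue_zpow r
  have hrootα := h.qPoch_root_zpow_ne_zero hdn hr hN
  have hrootp := h.qPoch_root_ne_zero hdn hN
  have hT : q ^ r * (q ^ d) ^ N = q ^ n := by
    rw [← zpow_natCast q n, ← hr, zpow_add₀ hq, zpow_mul, zpow_natCast, zpow_natCast]
  exact _root_.watson_shift (pow_ne_zero d hq) hα (hc.hasResidue.ne_zero hc.ne_zero) hT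
    (by rw [mul_assoc, hβ]; field_simp) ((hresp.qPoch hresp N).ne_zero hrootp)
    ((hresα.qPoch hresp N).ne_zero hrootα)
    (((hresp.div hresT one_ne_zero).qPoch hresp N).ne_zero (by rwa [div_one]))
    (((hresp.div hc.hasResidue hc.ne_zero).qPoch hresp N).ne_zero
      (h.qPoch_root_div_ne_zero hdn hc hN))
    (((hresp.mul hresT).qPoch hresp N).ne_zero (by rwa [mul_one]))
    (((hresα.mul hresT).qPoch hresp N).ne_zero (by rwa [mul_one]))
    (h.qPoch_mul_zpow_ne_zero hdn hr hN hc) h1 h2 (by rwa [zpow_mul', zpow_ofNat] at hden)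

lemma sum_lhsTerm_mul_shiftFactor_div_mul (h : IsCyclotomicPlace O q ζ n n)
    (hdn : d.Coprime n) (hd : d ≠ 0) (hr : r + d * N = n) (hN : N < n)
    (hc : IsGenericParameter O c γ n) (hden : qPoch (c * q ^ (2 * r)) (q ^ d) N ≠ 0) {β β' : F}
    (hβ : β * β' = (q ^ r) ^ 2) (h1 : qPoch (q ^ d / q ^ r * β') (q ^ d) N ≠ 0)
    (h2 : qPoch (q ^ d / q ^ r * β) (q ^ d) N ≠ 0) :
    ∑ k ∈ Finset.range (N + 1), lhsTerm q c d r k *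
        (shiftFactor (q ^ d) (q ^ n) (q ^ r) k / shiftFactor (q ^ d) (q ^ n) (q ^ d) k) *
        (qPoch β (q ^ d) k * qPoch β' (q ^ d) k / qPoch (q ^ r) (q ^ d) k ^ 2 *
          (qPoch (q ^ d) (q ^ d) k ^ 2 /
            (qPoch (q ^ d / q ^ r * β') (q ^ d) k * qPoch (q ^ d / q ^ r * β) (q ^ d) k))) =
      ∑ k ∈ Finset.range (N + 1), rhsCoeff q c n d r N k *
        (shiftFactor (q ^ d) (q ^ n) (q ^ r) k * (qPoch (q ^ d) (q ^ d) k ^ 2 /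
          (qPoch (q ^ d / q ^ r * β') (q ^ d) k * qPoch (q ^ d / q ^ r * β) (q ^ d) k))) := by
  have hq := h.ne_zero
  have hq1 : q ≠ 1 := fun hq1 => h.pow_ne_one (by rw [hq1, one_pow])
  have hα' := ((h.hasResidue_zpow r).qPoch (h.hasResidue.pow d) N).ne_zero
    (h.qPoch_root_zpow_ne_zero hdn hr hN)
  have hp' := ((h.hasResidue.pow d).qPoch (h.hasResidue.pow d) N).ne_zero
    (h.qPoch_root_ne_zero hdn hN)
  have key := h.watson_shift hdn hr hN hc hden hβ h1 h2
  rw [Finset.mul_sum] at key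
  refine mul_left_cancel₀ (sub_ne_zero.2 hq1.symm) ?_
  rw [Finset.mul_sum, Finset.mul_sum]
  refine (Finset.sum_congr rfl fun k hk => ?_).trans (key.trans
    (Finset.sum_congr rfl fun k hk => ?_))
  all_goals
    have hk' := Finset.mem_range_succ_iff.1 hk
    have hαk := qPoch_ne_zero_of_le hα' hk'
    have hpk := qPoch_ne_zero_of_le hp' hk'
  · have hcancel : qPoch (q ^ r) (q ^ d) k ^ 2 / qPoch (q ^ d) (q ^ d) k ^ 2 *
        (qPoch (q ^ d) (q ^ d) k ^ 2 / qPoch (q ^ r) (q ^ d) k ^ 2) = 1 := by field_simp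
    rw [← mul_assoc (1 - q), ← mul_assoc (1 - q), one_sub_mul_lhsTerm hq hq1]
    linear_combination (1 - q ^ r * ((q ^ d) ^ k) ^ 2) *
      (qPoch (q ^ r) (q ^ d) k ^ 3 * qPoch (c * q ^ r) (q ^ d) k /
        (qPoch (q ^ d) (q ^ d) k ^ 3 * qPoch (q ^ d / c) (q ^ d) k)) *
      ((q ^ d / (c * (q ^ r) ^ 2)) ^ k * (q ^ d / q ^ r) ^ k) *
      (shiftFactor (q ^ d) (q ^ n) (q ^ r) k / shiftFactor (q ^ d) (q ^ n) (q ^ d) k) *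
      (qPoch β (q ^ d) k * qPoch β' (q ^ d) k /
        (qPoch (q ^ d / q ^ r * β') (q ^ d) k * qPoch (q ^ d / q ^ r * β) (q ^ d) k)) * hcancel
  · have hcancel : 1 = qPoch (q ^ d) (q ^ d) k ^ 2 / qPoch (q ^ d) (q ^ d) k ^ 2 :=
      (div_self (pow_ne_zero 2 hpk)).symm
    rw [← mul_assoc, one_sub_mul_rhsCoeff hq hq1 c hd hr]
    linear_combination (1 - q ^ n) *
      (qPoch (c * (q ^ r) ^ 2) (q ^ d) N / qPoch (q ^ d / c) (q ^ d) N) / (c * q ^ r) ^ N *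
      (qPoch (q ^ r) (q ^ d) k ^ 2 * shiftFactor (q ^ d) (q ^ n) (q ^ r) k *
        qPoch (c * q ^ r) (q ^ d) k * qPoch (q ^ d / q ^ r) (q ^ d) k * (q ^ d) ^ k /
        (qPoch (q ^ d) (q ^ d) k * qPoch (q ^ d / q ^ r * β') (q ^ d) k *
          qPoch (q ^ d / q ^ r * β) (q ^ d) k * qPoch (c * (q ^ r) ^ 2) (q ^ d) k)) * hcancel

lemma sum_lhsTerm_mul_shiftFactor_div (h : IsCyclotomicPlace O q ζ n n)
    (hdn : d.Coprime n) (hd : d ≠ 0) (hr : r + d * N = n) (hN : N < n)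
    (hc : IsGenericParameter O c γ n) (hden : qPoch (c * q ^ (2 * r)) (q ^ d) N ≠ 0) :
    ∑ k ∈ Finset.range (N + 1), lhsTerm q c d r k *
        (shiftFactor (q ^ d) (q ^ n) (q ^ r) k / shiftFactor (q ^ d) (q ^ n) (q ^ d) k) =
      ∑ k ∈ Finset.range (N + 1),
        rhsCoeff q c n d r N k * shiftFactor (q ^ d) (q ^ n) (q ^ r) k := by
  have hα' := ((h.hasResidue_zpow r).qPoch (h.hasResidue.pow d) N).ne_zero
    (h.qPoch_root_zpow_ne_zero hdn hr hN)
  have hp' := ((h.hasResidue.pow d).qPoch (h.hasResidue.pow d) N).ne_zero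
    (h.qPoch_root_ne_zero hdn hN)
  have hl : q ^ d / q ^ r * q ^ r = q ^ d := div_mul_cancel₀ _ (zpow_ne_zero r h.ne_zero)
  have key := h.sum_lhsTerm_mul_shiftFactor_div_mul hdn hd hr hN hc hden (sq (q ^ r)).symm
    (hl.symm ▸ hp') (hl.symm ▸ hp')
  simp only [hl, ← sq] at key
  refine (Finset.sum_congr rfl fun k hk => ?_).trans
    (key.trans (Finset.sum_congr rfl fun k hk => ?_))
  all_goals
    have hpk := qPoch_ne_zero_of_le hp' (Finset.mem_range_succ_iff.1 hk)
    rw [div_self (pow_ne_zero 2 hpk), mul_one]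
  rw [div_self (pow_ne_zero 2 (qPoch_ne_zero_of_le hα' (Finset.mem_range_succ_iff.1 hk))),
    mul_one]

lemma sum_lhsTerm_mul_shiftFactor_div_sq (h : IsCyclotomicPlace O q ζ n n)
    (hdn : d.Coprime n) (hd : d ≠ 0) (hr : r + d * N = n) (hN : N < n)
    (hc : IsGenericParameter O c γ n) (hden : qPoch (c * q ^ (2 * r)) (q ^ d) N ≠ 0) :
    ∑ k ∈ Finset.range (N + 1), lhsTerm q c d r k *
        (shiftFactor (q ^ d) (q ^ n) (q ^ r) k / shiftFactor (q ^ d) (q ^ n) (q ^ d) k) ^ 2 =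
      ∑ k ∈ Finset.range (N + 1), rhsCoeff q c n d r N k *
        (shiftFactor (q ^ d) (q ^ n) (q ^ r) k / shiftFactor (q ^ d) (q ^ n) (q ^ d) k) := by
  have hα : q ^ r ≠ 0 := zpow_ne_zero r h.ne_zero
  have hT : q ^ n ≠ 0 := pow_ne_zero n h.ne_zero
  have hresT : HasResidue O (q ^ n) 1 := h.root_pow_eq_one ▸ h.hasResidue.pow n
  have hresp := h.hasResidue.pow d
  have hα' := ((h.hasResidue_zpow r).qPoch hresp N).ne_zero (h.qPoch_root_zpow_ne_zero hdn hr hN)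
  have hrootp := h.qPoch_root_ne_zero hdn hN
  have hp' := (hresp.qPoch hresp N).ne_zero hrootp
  have hl : q ^ d / q ^ r * (q ^ r / q ^ n) = q ^ d / q ^ n := by field_simp
  have hl' : q ^ d / q ^ r * (q ^ r * q ^ n) = q ^ d * q ^ n := by field_simp
  have key := h.sum_lhsTerm_mul_shiftFactor_div_mul hdn hd hr hN hc hden
    (β := q ^ r * q ^ n) (β' := q ^ r / q ^ n) (by field_simp)
    (by rw [hl]; exact ((hresp.div hresT one_ne_zero).qPoch hresp N).ne_zero (by rwa [div_one]))
    (by rw [hl']; exact ((hresp.mul hresT).qPoch hresp N).ne_zero (by rwa [mul_one]))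
  rw [hl, hl'] at key
  refine (Finset.sum_congr rfl fun k hk => ?_).trans
    (key.trans (Finset.sum_congr rfl fun k hk => ?_))
  all_goals
    have hpk := pow_ne_zero 2 (qPoch_ne_zero_of_le hp' (Finset.mem_range_succ_iff.1 hk))
    rw [mul_comm (qPoch (q ^ d / q ^ n) (q ^ d) k),
      qPoch_mul_qPoch_div hT (qPoch_ne_zero_of_le hp' (Finset.mem_range_succ_iff.1 hk)),
      ← div_div, div_self hpk, one_div]
  · rw [qPoch_mul_qPoch_div hT (qPoch_ne_zero_of_le hα' (Finset.mem_range_succ_iff.1 hk)),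
      mul_div_cancel_left₀ _
        (pow_ne_zero 2 (qPoch_ne_zero_of_le hα' (Finset.mem_range_succ_iff.1 hk)))]
    ring
  · rw [← div_eq_mul_inv]

end IsCyclotomicPlace

end PerturbedTransformation

section FirstOrder

variable {F : Type*} [Field F] {O : ValuationSubring F} {ε x y a b : F}

/-- The expansion `x = 1 + ε a + O(ε²)` with error term in the valuation ring `O`; here `ε` is an
arbitrary element, in the applications one of the maximal ideal. -/
def HasFirstOrder (O : ValuationSubring F) (ε x a : F) : Prop :=
  ∃ s ∈ O, x = 1 + ε * a + ε ^ 2 * s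

namespace HasFirstOrder

lemma prod_one_add (hε : ε ∈ O) {ι : Type*} {s : Finset ι} {f : ι → F} (hf : ∀ i ∈ s, f i ∈ O) :
    HasFirstOrder O ε (∏ i ∈ s, (1 + ε * f i)) (∑ i ∈ s, f i) := by
  classical
  induction s using Finset.induction_on with
  | empty => exact ⟨0, zero_mem O, by simp⟩
  | insert i s hi ih =>
    rw [Finset.forall_mem_insert] at hf
    obtain ⟨t, ht, hprod⟩ := ih hf.2
    refine ⟨t + f i * (∑ j ∈ s, f j) + ε * f i * t, add_mem (add_mem ht
      (mul_mem hf.1 (sum_mem hf.2))) (mul_mem (mul_mem hε hf.1) ht), ?_⟩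
    rw [Finset.prod_insert hi, Finset.sum_insert hi, hprod]
    ring

lemma valuation_eq_one (hy : HasFirstOrder O ε y b) (hε : O.valuation ε < 1) (hb : b ∈ O) :
    O.valuation y = 1 := by
  obtain ⟨t, ht, rfl⟩ := hy
  have hεO : ε ∈ O := (O.valuation_le_one_iff ε).1 hε.le
  rw [show 1 + ε * b + ε ^ 2 * t = 1 + ε * (b + ε * t) by ring]
  refine Valuation.map_one_add_of_lt _ ?_
  rw [map_mul]
  exact mul_lt_one_of_lt_of_le hε ((O.valuation_le_one_iff _).2 (add_mem hb (mul_mem hεO ht)))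

lemma inv (hy : HasFirstOrder O ε y b) (hε : O.valuation ε < 1) (hb : b ∈ O) :
    HasFirstOrder O ε y⁻¹ (-b) := by
  have hy1 := hy.valuation_eq_one hε hb
  have hy0 : y ≠ 0 := (Valuation.ne_zero_iff _).1 (hy1.trans_ne one_ne_zero)
  have hinv : y⁻¹ ∈ O := (O.valuation_le_one_iff _).1 (by rw [map_inv₀, hy1, inv_one])
  have hεO : ε ∈ O := (O.valuation_le_one_iff ε).1 hε.le
  obtain ⟨t, ht, hyt⟩ := hy
  refine ⟨(b ^ 2 - t + ε * b * t) * y⁻¹, mul_mem (add_mem (sub_mem (pow_mem hb 2) ht)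
    (mul_mem (mul_mem hεO hb) ht)) hinv, ?_⟩
  field_simp
  rw [hyt]
  ring

lemma mul (hε : ε ∈ O) (hx : HasFirstOrder O ε x a) (hy : HasFirstOrder O ε y b) (ha : a ∈ O)
    (hb : b ∈ O) : HasFirstOrder O ε (x * y) (a + b) := by
  obtain ⟨s, hs, rfl⟩ := hx
  obtain ⟨t, ht, rfl⟩ := hy
  refine ⟨s + t + a * b + ε * (a * t + b * s) + ε ^ 2 * (s * t), ?_, by ring⟩
  exact add_mem (add_mem (add_mem (add_mem hs ht) (mul_mem ha hb))
    (mul_mem hε (add_mem (mul_mem ha ht) (mul_mem hb hs)))) (mul_mem (pow_mem hε 2) (mul_mem hs ht))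

lemma two_sub (hy : HasFirstOrder O ε y b) : HasFirstOrder O ε (2 - y) (-b) := by
  obtain ⟨t, ht, rfl⟩ := hy
  exact ⟨-t, neg_mem ht, by ring⟩

lemma exists_sub_one_sq (hε : ε ∈ O) (hx : HasFirstOrder O ε x a) (ha : a ∈ O) :
    ∃ s ∈ O, (x - 1) ^ 2 = ε ^ 2 * a ^ 2 + ε ^ 3 * s := by
  obtain ⟨s, hs, rfl⟩ := hx
  refine ⟨2 * a * s + ε * s ^ 2, ?_, by ring⟩
  exact add_mem (mul_mem (mul_mem (ofNat_mem O 2) ha) hs) (mul_mem hε (pow_mem hs 2))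

end HasFirstOrder

variable {ω κ : F}

lemma valuation_perturbed_term_le (hω : ω ∈ O) (hε : O.valuation ε ≤ O.valuation ω ^ 2)
    (hε1 : O.valuation ε < 1) (hκ : O.valuation (ε + κ) ≤ O.valuation ω ^ 4) {t e : F}
    (ht : t ∈ O) (he : O.valuation e ≤ O.valuation ω) (ha : a ∈ O) (hb : b ∈ O)
    (hx : HasFirstOrder O ε x a) (hy : HasFirstOrder O ε y b) :
    O.valuation (e * (x * (2 - y⁻¹) - 1 + κ * (a + b)) +
      t * ((x / y - 1) ^ 2 - ε ^ 2 * (a - b) ^ 2)) ≤ O.valuation ω ^ 5 := by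
  have hεO : ε ∈ O := (O.valuation_le_one_iff ε).1 hε1.le
  have hω1 := (O.valuation_le_one_iff ω).2 hω
  have hyinv := hy.inv hε1 hb
  obtain ⟨s, hs, hlin⟩ := hx.mul hεO hyinv.two_sub ha (neg_mem (neg_mem hb))
  obtain ⟨s', hs', hsq⟩ := (hx.mul hεO hyinv ha (neg_mem hb)).exists_sub_one_sq hεO
    (add_mem ha (neg_mem hb))
  rw [hlin, div_eq_mul_inv, hsq]
  have hsplit : e * (1 + ε * (a + - -b) + ε ^ 2 * s - 1 + κ * (a + b)) +
      t * (ε ^ 2 * (a + -b) ^ 2 + ε ^ 3 * s' - ε ^ 2 * (a - b) ^ 2) =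
      e * ((ε + κ) * (a + b) + ε ^ 2 * s) + ε ^ 3 * (t * s') := by ring
  rw [hsplit]
  have hε2 : O.valuation ε ^ 2 ≤ O.valuation ω ^ 4 :=
    (pow_le_pow_left' hε 2).trans_eq (pow_mul _ 2 2).symm
  have hrem {z : F} (hz : z ∈ O) : O.valuation (ε ^ 2 * z) ≤ O.valuation ω ^ 4 := by
    rw [map_mul, map_pow]
    exact (mul_le_of_le_one_right' ((O.valuation_le_one_iff z).2 hz)).trans hε2
  refine Valuation.map_add_le _ ?_ ?_
  · rw [map_mul, pow_succ' _ 4]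
    refine mul_le_mul' he (Valuation.map_add_le _ ?_ (hrem hs))
    rw [map_mul]
    exact (mul_le_of_le_one_right' ((O.valuation_le_one_iff _).2 (add_mem ha hb))).trans hκ
  · rw [pow_succ' ε 2, mul_assoc, map_mul, pow_succ' _ 4]
    exact mul_le_mul' (hε.trans (pow_le_of_le_one zero_le hω1 two_ne_zero))
      (hrem (mul_mem ht hs'))

lemma valuation_sum_sub_sum_le (hω : ω ∈ O) (hε : O.valuation ε ≤ O.valuation ω ^ 2)
    (hε1 : O.valuation ε < 1) (hκ : O.valuation (ε + κ) ≤ O.valuation ω ^ 4) {S : Finset ℕ}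
    {T E A B a b : ℕ → F} (hT : ∀ k ∈ S, T k ∈ O) (hE : ∀ k ∈ S, O.valuation (E k) ≤ O.valuation ω)
    (ha : ∀ k ∈ S, a k ∈ O) (hb : ∀ k ∈ S, b k ∈ O)
    (hA : ∀ k ∈ S, HasFirstOrder O ε (A k) (a k)) (hB : ∀ k ∈ S, HasFirstOrder O ε (B k) (b k))
    (hsymm : O.valuation (∑ k ∈ S, T k * (a k - b k) ^ 2) ≤ O.valuation ω)
    (h1 : ∑ k ∈ S, T k * (A k / B k) = ∑ k ∈ S, E k * A k)
    (h2 : ∑ k ∈ S, T k * (A k / B k) ^ 2 = ∑ k ∈ S, E k * (A k / B k)) :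
    O.valuation (∑ k ∈ S, T k - ∑ k ∈ S, E k * (1 - κ * (a k + b k))) ≤ O.valuation ω ^ 5 := by
  have hsplit : ∑ k ∈ S, T k - ∑ k ∈ S, E k * (1 - κ * (a k + b k)) =
      ∑ k ∈ S, (E k * (A k * (2 - (B k)⁻¹) - 1 + κ * (a k + b k)) +
        T k * ((A k / B k - 1) ^ 2 - ε ^ 2 * (a k - b k) ^ 2)) +
      ε ^ 2 * ∑ k ∈ S, T k * (a k - b k) ^ 2 := by
    have hterm (k : ℕ) : E k * (A k * (2 - (B k)⁻¹) - 1 + κ * (a k + b k)) +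
        T k * ((A k / B k - 1) ^ 2 - ε ^ 2 * (a k - b k) ^ 2) =
        T k - E k * (1 - κ * (a k + b k)) + 2 * (E k * A k - T k * (A k / B k)) -
          (E k * (A k / B k) - T k * (A k / B k) ^ 2) - ε ^ 2 * (T k * (a k - b k) ^ 2) := by ring
    simp only [hterm, Finset.sum_sub_distrib, Finset.sum_add_distrib, ← Finset.mul_sum, h1, h2]
    ring
  rw [hsplit]
  refine Valuation.map_add_le _ (Valuation.map_sum_le _ fun k hk =>
    valuation_perturbed_term_le hω hε hε1 hκ (hT k hk) (hE k hk) (ha k hk) (hb k hk) (hA k hk)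
      (hB k hk)) ?_
  rw [map_mul, map_pow, pow_succ]
  exact mul_le_mul' ((pow_le_pow_left' hε 2).trans_eq (pow_mul _ 2 2).symm) hsymm

end FirstOrder

section ShiftSum

/-- The first-order coefficient of `shiftFactor p T x k` in `2 - T - T⁻¹`. -/
def shiftSum {F : Type*} [Field F] (p x : F) (k : ℕ) : F :=
  ∑ i ∈ Finset.range k, x * p ^ i / (1 - x * p ^ i) ^ 2

lemma inv_div_one_sub_inv_sq {F : Type*} [Field F] {x : F} (hx : x ≠ 0) :
    x⁻¹ / (1 - x⁻¹) ^ 2 = x / (1 - x) ^ 2 := by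
  rw [show 1 - x⁻¹ = -((1 - x) / x) by rw [sub_div, div_self hx, one_div, neg_sub], neg_sq, div_pow]
  field_simp

lemma shiftSum_inv_pow_add {F : Type*} [Field F] {p : F} (hp : p ≠ 0) (i j : ℕ) :
    shiftSum p (p ^ (i + j))⁻¹ j + shiftSum p p i = shiftSum p p (i + j) := by
  rw [add_comm, shiftSum, shiftSum, shiftSum, Finset.sum_range_add, add_right_inj,
    ← Finset.sum_range_reflect (fun l => p * p ^ (i + l) / _)]
  refine Finset.sum_congr rfl fun l hl => ?_
  have hl := Finset.mem_range.1 hl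
  have hinv : (p ^ (i + j))⁻¹ * p ^ l = (p ^ (i + j - l))⁻¹ := by
    rw [← Nat.sub_add_cancel (show l ≤ i + j by lia), pow_add, mul_inv,
      inv_mul_cancel_right₀ (pow_ne_zero l hp), Nat.add_sub_cancel]
  rw [hinv, inv_div_one_sub_inv_sq (pow_ne_zero _ hp), ← pow_succ',
    show i + (j - 1 - l) + 1 = i + j - l by lia]

lemma harmSum_eq_shiftSum {F : Type*} [Field F] {q : F} (hq : q ≠ 0) (d : ℕ) (r : ℤ) (k : ℕ) :
    harmSum q d r k = (1 - q) ^ 2 * (shiftSum (q ^ d) (q ^ r) k + shiftSum (q ^ d) (q ^ d) k) := by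
  have hterm (a : ℤ) : q ^ a / qInt q a ^ 2 = (1 - q) ^ 2 * (q ^ a / (1 - q ^ a) ^ 2) := by
    rw [qInt, div_pow, div_div_eq_mul_div, mul_comm, mul_div_assoc]
  have hpow (a : ℤ) (i : ℕ) : q ^ (a + d * i) = q ^ a * (q ^ d) ^ i := by
    rw [zpow_add₀ hq, zpow_mul, zpow_natCast, zpow_natCast]
  rw [harmSum, shiftSum, shiftSum]
  induction k with
  | zero => simp
  | succ k ih =>
    rw [Finset.sum_Icc_succ_top (by lia), ih, Finset.sum_range_succ, Finset.sum_range_succ,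
      ← zpow_natCast q (d * (k + 1)), Nat.cast_mul, hterm, hterm,
      show (d : ℤ) * (k + 1 : ℕ) - d + r = r + d * k by push_cast; ring,
      show (d : ℤ) * (k + 1 : ℕ) = d + d * k by push_cast; ring, hpow, hpow, zpow_natCast]
    ring

variable {F : Type*} [Field F] {O : ValuationSubring F} {p x : F}
  {p' x' : IsLocalRing.ResidueField O} {k : ℕ}

lemma hasResidue_shiftSum (hx : HasResidue O x x') (hp : HasResidue O p p')
    (h : qPoch x' p' k ≠ 0) : HasResidue O (shiftSum p x k) (shiftSum p' x' k) :=
  HasResidue.sum fun i hi => (hx.mul (hp.pow i)).div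
    ((HasResidue.one.sub (hx.mul (hp.pow i))).pow 2)
    (pow_ne_zero 2 (qPoch_ne_zero_iff.1 h i (Finset.mem_range.1 hi)))

lemma hasFirstOrder_shiftFactor {T : F} (hT : 2 - T - T⁻¹ ∈ O) (hx : HasResidue O x x')
    (hp : HasResidue O p p') (h : qPoch x' p' k ≠ 0) :
    HasFirstOrder O (2 - T - T⁻¹) (shiftFactor p T x k) (shiftSum p x k) :=
  HasFirstOrder.prod_one_add hT fun i hi => ((hx.mul (hp.pow i)).div
    ((HasResidue.one.sub (hx.mul (hp.pow i))).pow 2)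
    (pow_ne_zero 2 (qPoch_ne_zero_iff.1 h i (Finset.mem_range.1 hi)))).mem

end ShiftSum

section OrderFive

open IsLocalRing

variable {F : Type*} [Field F] {O : ValuationSubring F} {q c : F} {ζ γ : ResidueField O}
  {d m n N k : ℕ} {r : ℤ}

lemma add_mul_ne_zero (hdn : d.Coprime n) (hr : r + d * N = n) (hN : N < n) (j : ℕ) :
    r + d * j ≠ 0 := fun h0 => by
  have hmul : (d : ℤ) * (N - j) = n := by rw [← hr, mul_sub, eq_sub_of_add_eq h0]; ring
  obtain rfl : d = 1 := hdn.eq_one_of_dvd (Int.natCast_dvd_natCast.1 ⟨_, hmul.symm⟩)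
  lia

namespace IsCyclotomicPlace

lemma hasResidue_lhsTerm [CharZero (ResidueField O)] (h : IsCyclotomicPlace O q ζ n n) (hn : n ≠ 1)
    (hdn : d.Coprime n) (hd : d ≠ 0) (hr : r + d * N = n) (hc : IsGenericParameter O c γ n)
    (hk : k < n) : HasResidue O (lhsTerm q c d r k) (lhsTerm ζ γ d r k) := by
  obtain ⟨σ, hσ⟩ := h.exists_hasResidue_lhsFactor_add hdn hd hr hc 0
  simp only [zero_mul, zero_add] at hσ
  have hσ1 : σ = 1 := by
    simpa [lhsFactor] using (hσ 0 h.order_pos).unique (by simpa [lhsFactor] using HasResidue.one)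
  simpa only [lhsTerm, hσ1, one_mul] using
    (h.hasResidue.qInt h.root_ne_zero (h.root_ne_one hn) _).mul (hσ k hk)

lemma valuation_lhsTerm_le_pow_five [CharZero (ResidueField O)] (h : IsCyclotomicPlace O q ζ n n)
    (hn : n ≠ 1) (hdn : d.Coprime n) (hd : d ≠ 0) (hr : r + d * N = n)
    (hc : IsGenericParameter O c γ n) (hNk : N < k) (hk : k < n) :
    O.valuation (lhsTerm q c d r k) ≤ O.valuation (1 - q ^ n) ^ 5 := by
  have hqr : HasResidue O (qPoch (q ^ r) (q ^ d) k) 0 := by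
    have hroot : qPoch (ζ ^ r) (ζ ^ d) k = 0 := by
      rw [h.root_zpow_eq hr, Nat.mod_eq_of_lt (hNk.trans hk)]
      exact qPoch_inv_pow_eq_zero (pow_ne_zero d h.root_ne_zero) hNk
    exact hroot ▸ (h.hasResidue_zpow r).qPoch (h.hasResidue.pow d) k
  have hqPoch : O.valuation (qPoch (q ^ r) (q ^ d) k / qPoch (q ^ d) (q ^ d) k) ≤
      O.valuation (1 - q ^ n) := by
    have hunit := ((h.hasResidue.pow d).qPoch (h.hasResidue.pow d) k).valuation_eq_one
      (h.qPoch_root_ne_zero hdn hk)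
    rw [map_div₀, hunit, div_one]
    exact h.valuation_le_of_hasResidue_zero hqr
  have hqPochc := h.valuation_qPoch_mul_div_qPoch_div_le_one hdn hd hc (h.dvd_add_mul hr) k
  have harg := ((h.hasResidue_zpow (2 * (d : ℤ) - 3 * r)).div hc.hasResidue
    hc.ne_zero).valuation_le_one
  have hint := (h.hasResidue.qInt h.root_ne_zero (h.root_ne_one hn)
    (2 * d * k + r)).valuation_le_one
  rw [lhsTerm, lhsFactor, mul_div_mul_comm, ← div_pow, map_mul, map_mul, map_mul, map_pow, map_pow]
  exact mul_le_of_le_one_of_le hint (mul_le_of_le_of_le_one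
    (mul_le_of_le_of_le_one (pow_le_pow_left' hqPoch 5) hqPochc) (pow_le_one' harg k))

lemma shiftSum_root_sub_symm (h : IsCyclotomicPlace O q ζ n n) (hr : r + d * N = n) (hN : N < n)
    {i j : ℕ} (hij : i + j = N) :
    shiftSum (ζ ^ d) (ζ ^ r) i - shiftSum (ζ ^ d) (ζ ^ d) i =
      shiftSum (ζ ^ d) (ζ ^ r) j - shiftSum (ζ ^ d) (ζ ^ d) j := by
  have hξ : ζ ^ d ≠ 0 := pow_ne_zero d h.root_ne_zero
  rw [h.root_zpow_eq hr, Nat.mod_eq_of_lt hN, ← hij]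
  have hij := shiftSum_inv_pow_add hξ i j
  have hji := shiftSum_inv_pow_add hξ j i
  rw [add_comm j i] at hji
  linear_combination hji - hij

lemma qInt_sq_mul_harmSum (h : IsCyclotomicPlace O q ζ m n) (k : ℕ) :
    qInt q n ^ 2 * (2 - q ^ n) * harmSum q d r k = (1 - q ^ n) ^ 2 * (2 - q ^ n) *
      (shiftSum (q ^ d) (q ^ r) k + shiftSum (q ^ d) (q ^ d) k) := by
  have hq1 : 1 - q ≠ 0 := sub_ne_zero.2 fun hq1 => h.pow_ne_one (by rw [← hq1, one_pow])
  rw [harmSum_eq_shiftSum h.ne_zero, qInt, zpow_natCast]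
  field_simp

lemma valuation_inv_pow (h : IsCyclotomicPlace O q ζ m n) : O.valuation (q ^ n)⁻¹ = 1 := by
  simpa only [zpow_neg, zpow_natCast] using h.valuation_zpow (-n)

lemma valuation_two_sub_sub_inv (h : IsCyclotomicPlace O q ζ m n) :
    O.valuation (2 - q ^ n - (q ^ n)⁻¹) = O.valuation (1 - q ^ n) ^ 2 := by
  have hqn : q ^ n ≠ 0 := pow_ne_zero n h.ne_zero
  have heq : 2 - q ^ n - (q ^ n)⁻¹ = -((1 - q ^ n) ^ 2 * (q ^ n)⁻¹) := by field_simp; ring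
  rw [heq, Valuation.map_neg, map_mul, map_pow, h.valuation_inv_pow, mul_one]

lemma valuation_two_sub_sub_inv_add (h : IsCyclotomicPlace O q ζ m n) :
    O.valuation (2 - q ^ n - (q ^ n)⁻¹ + (1 - q ^ n) ^ 2 * (2 - q ^ n)) =
      O.valuation (1 - q ^ n) ^ 4 := by
  have hqn : q ^ n ≠ 0 := pow_ne_zero n h.ne_zero
  have heq : 2 - q ^ n - (q ^ n)⁻¹ + (1 - q ^ n) ^ 2 * (2 - q ^ n) =
      -((1 - q ^ n) ^ 4 * (q ^ n)⁻¹) := by field_simp; ring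
  rw [heq, Valuation.map_neg, map_mul, map_pow, h.valuation_inv_pow, mul_one]

lemma valuation_sum_lhsTerm_mul_sq_le [CharZero (ResidueField O)]
    (h : IsCyclotomicPlace O q ζ n n) (hn : n ≠ 1) (hdn : d.Coprime n) (hd : d ≠ 0)
    (hr : r + d * N = n) (hN : N < n) (hc : IsGenericParameter O c γ n) :
    O.valuation (∑ k ∈ Finset.range (N + 1), lhsTerm q c d r k *
      (shiftSum (q ^ d) (q ^ r) k - shiftSum (q ^ d) (q ^ d) k) ^ 2) ≤ O.valuation (1 - q ^ n) := by
  have hp := h.hasResidue.pow d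
  have hroot : ∑ k ∈ Finset.range (N + 1), lhsTerm ζ γ d r k *
      (shiftSum (ζ ^ d) (ζ ^ r) k - shiftSum (ζ ^ d) (ζ ^ d) k) ^ 2 = 0 :=
    sum_range_eq_zero_of_antisymm fun i j hij => by
      rw [h.lhsTerm_root_antisymm hdn hr hc (hij.trans (Nat.mod_eq_of_lt hN).symm),
        h.shiftSum_root_sub_symm hr hN hij, neg_mul]
  refine h.valuation_le_of_hasResidue_zero (hroot ▸ HasResidue.sum fun k hk => ?_)
  have hk := Finset.mem_range_succ_iff.1 hk
  exact (h.hasResidue_lhsTerm hn hdn hd hr hc (hk.trans_lt hN)).mul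
    (((hasResidue_shiftSum (h.hasResidue_zpow r) hp
      (qPoch_ne_zero_of_le (h.qPoch_root_zpow_ne_zero hdn hr hN) hk)).sub
    (hasResidue_shiftSum hp hp (h.qPoch_root_ne_zero hdn (hk.trans_lt hN)))).pow 2)

lemma valuation_lhsSum_sub_rhsSum_le [CharZero (ResidueField O)]
    (h : IsCyclotomicPlace O q ζ n n) (hn : n ≠ 1) (hdn : d.Coprime n) (hd : d ≠ 0)
    (hr : r + d * N = n) (hN : N < n) (hc : IsGenericParameter O c γ n)
    (hden : qPoch (c * q ^ (2 * r)) (q ^ d) N ≠ 0) :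
    O.valuation (lhsSum q c d r N - rhsSum q c n d r N) ≤ O.valuation (1 - q ^ n) ^ 5 := by
  have hεv := h.valuation_two_sub_sub_inv
  have hlt := h.valuation_one_sub_pow_lt_one
  have hε1 := hεv.trans_lt (pow_lt_one' hlt two_ne_zero)
  have hεO := (O.valuation_le_one_iff _).1 hε1.le
  have hp := h.hasResidue.pow d
  have hα := h.hasResidue_zpow r
  have hk {k : ℕ} (hk : k ∈ Finset.range (N + 1)) : k ≤ N := Finset.mem_range_succ_iff.1 hk
  have hrootα {k : ℕ} (hkN : k ∈ Finset.range (N + 1)) : qPoch (ζ ^ r) (ζ ^ d) k ≠ 0 :=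
    qPoch_ne_zero_of_le (h.qPoch_root_zpow_ne_zero hdn hr hN) (hk hkN)
  have hrootp {k : ℕ} (hkN : k ∈ Finset.range (N + 1)) : qPoch (ζ ^ d) (ζ ^ d) k ≠ 0 :=
    h.qPoch_root_ne_zero hdn ((hk hkN).trans_lt hN)
  rw [lhsSum_eq_sum_lhsTerm, rhsSum_eq_sum_rhsCoeff]
  simp only [h.qInt_sq_mul_harmSum]
  exact valuation_sum_sub_sum_le ((O.valuation_le_one_iff _).1 hlt.le) hεv.le hε1
    h.valuation_two_sub_sub_inv_add.le
    (fun k hkN => (h.hasResidue_lhsTerm hn hdn hd hr hc ((hk hkN).trans_lt hN)).mem)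
    (fun k hkN => h.valuation_rhsCoeff_le hn hdn hd hr hc hden (hk hkN))
    (fun k hkN => (hasResidue_shiftSum hα hp (hrootα hkN)).mem)
    (fun k hkN => (hasResidue_shiftSum hp hp (hrootp hkN)).mem)
    (fun k hkN => hasFirstOrder_shiftFactor hεO hα hp (hrootα hkN))
    (fun k hkN => hasFirstOrder_shiftFactor hεO hp hp (hrootp hkN))
    (h.valuation_sum_lhsTerm_mul_sq_le hn hdn hd hr hN hc)
    (h.sum_lhsTerm_mul_shiftFactor_div hdn hd hr hN hc hden)
    (h.sum_lhsTerm_mul_shiftFactor_div_sq hdn hd hr hN hc hden)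

lemma valuation_lhsSum_sub_rhsSum_le_of_eq_or_eq [CharZero (ResidueField O)]
    (h : IsCyclotomicPlace O q ζ n n) (hn : n ≠ 1) (hdn : d.Coprime n) (hd : d ≠ 0)
    (hr : r + d * N = n) (hN : N < n) (hc : IsGenericParameter O c γ n)
    (hden : qPoch (c * q ^ (2 * r)) (q ^ d) N ≠ 0) {M : ℕ} (hM : M = N ∨ M = n - 1) :
    O.valuation (lhsSum q c d r M - rhsSum q c n d r N) ≤ O.valuation (1 - q ^ n) ^ 5 := by
  have hmain := h.valuation_lhsSum_sub_rhsSum_le hn hdn hd hr hN hc hden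
  rcases hM with rfl | rfl
  · exact hmain
  have htail : lhsSum q c d r (n - 1) = lhsSum q c d r N +
      ∑ k ∈ Finset.Ico (N + 1) n, lhsTerm q c d r k := by
    rw [lhsSum_eq_sum_lhsTerm, lhsSum_eq_sum_lhsTerm, Nat.sub_add_cancel (Nat.zero_lt_of_lt hN),
      Finset.sum_range_add_sum_Ico _ hN]
  rw [htail, add_sub_right_comm]
  refine Valuation.map_add_le _ hmain (Valuation.map_sum_le _ fun k hk => ?_)
  rw [Finset.mem_Ico] at hk
  exact h.valuation_lhsTerm_le_pow_five hn hdn hd hr hc hk.1 hk.2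

end IsCyclotomicPlace

end OrderFive

section PolynomialPlace

open IsDedekindDomain IsLocalRing

lemma valuation_le_of_lt_one_of_notMem_sq {R F : Type*} [CommRing R] [IsDedekindDomain R] [Field F]
    [Algebra R F] [IsFractionRing R F] (v : HeightOneSpectrum R) {a : R} (ha : a ∉ v.asIdeal ^ 2)
    {x : F} (hx : v.valuation F x < 1) : v.valuation F x ≤ v.valuation F (algebraMap R F a) := by
  rcases eq_or_ne x 0 with rfl | hx0
  · rw [map_zero]
    exact zero_le
  have ha0 : a ≠ 0 := fun h => ha (h ▸ zero_mem _)
  have hva := v.intValuation_ne_zero a ha0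
  have hvx : v.valuation F x ≠ 0 := (Valuation.ne_zero_iff _).2 hx0
  rw [← v.intValuation_le_pow_iff_mem, not_le, ← WithZero.lt_log_iff_exp_lt hva] at ha
  rw [← WithZero.log_lt_log hvx one_ne_zero, WithZero.log_one] at hx
  rw [v.valuation_of_algebraMap, ← WithZero.log_le_log hvx hva]
  lia

lemma notMem_sq_of_squarefree {R : Type*} [CommRing R] [IsDomain R] [IsPrincipalIdealRing R]
    (v : HeightOneSpectrum R) {a : R} (ha : Squarefree a) : a ∉ v.asIdeal ^ 2 := by
  obtain ⟨π, hπ⟩ := IsPrincipalIdealRing.principal v.asIdeal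
  rw [Ideal.submodule_span_eq] at hπ
  rw [hπ, Ideal.span_singleton_pow, Ideal.mem_span_singleton, sq]
  exact fun h => v.isPrime.ne_top (hπ.trans (Ideal.span_singleton_eq_top.2 (ha π h)))

variable {K : Type*} [Field K] (v : HeightOneSpectrum K[X])

/-- The valuation ring of `K(q)` consisting of the rational functions without a pole at the prime
`v` of `K[q]`. -/
noncomputable def placeAt : ValuationSubring (RatFunc K) :=
  (v.valuation (RatFunc K)).valuationSubring

lemma isEquiv_valuation_placeAt : (v.valuation (RatFunc K)).IsEquiv (placeAt v).valuation :=
  Valuation.isEquiv_valuation_valuationSubring _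

/-- Reduction of polynomials modulo the prime `v`, with values in the residue field of
`placeAt v`. -/
noncomputable def reductionAt : K[X] →+* ResidueField (placeAt v) :=
  (residue _).comp ((algebraMap K[X] (RatFunc K)).codRestrict (placeAt v) v.valuation_le_one)

variable {v} {f g : K[X]}

lemma hasResidue_algebraMap (f : K[X]) :
    HasResidue (placeAt v) (algebraMap K[X] (RatFunc K) f) (reductionAt v f) :=
  ⟨_, rfl, rfl⟩

lemma valuation_algebraMap_lt_one_iff :
    (placeAt v).valuation (algebraMap K[X] (RatFunc K) f) < 1 ↔ f ∈ v.asIdeal := by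
  rw [← (isEquiv_valuation_placeAt v).lt_one_iff_lt_one]
  exact v.valuation_lt_one_iff_mem f

lemma reductionAt_eq_zero_iff : reductionAt v f = 0 ↔ f ∈ v.asIdeal := by
  rw [← valuation_algebraMap_lt_one_iff]
  refine ⟨fun h => (h ▸ hasResidue_algebraMap f).valuation_lt_one, fun h => ?_⟩
  contrapose! h
  exact ((hasResidue_algebraMap f).valuation_eq_one h).ge

lemma charZero_residueField_placeAt [CharZero K] : CharZero (ResidueField (placeAt v)) :=
  charZero_of_injective_ringHom ((reductionAt v).comp C).injective

lemma valuation_algebraMap_le_of_dvd (h : f ∣ g) :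
    (placeAt v).valuation (algebraMap K[X] (RatFunc K) g) ≤
      (placeAt v).valuation (algebraMap K[X] (RatFunc K) f) := by
  obtain ⟨g, rfl⟩ := h
  rw [map_mul, map_mul]
  exact mul_le_of_le_one_right' (hasResidue_algebraMap g).valuation_le_one

lemma ratCongr_of_valuation_le {P : K[X]} (hP : P ≠ 0) {x y : RatFunc K}
    (h : ∀ v : HeightOneSpectrum K[X], P ∈ v.asIdeal →
      (placeAt v).valuation (x - y) ≤ (placeAt v).valuation (algebraMap K[X] (RatFunc K) P)) :
    RatCongr P x y := by
  have hP' : algebraMap K[X] (RatFunc K) P ≠ 0 := RatFunc.algebraMap_ne_zero hP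
  set w := (x - y) / algebraMap K[X] (RatFunc K) P with hw
  have hwP : x - y = algebraMap K[X] (RatFunc K) (P * w.num) /
      algebraMap K[X] (RatFunc K) w.denom := by
    rw [map_mul, mul_div_assoc, RatFunc.num_div_denom, hw, mul_div_cancel₀ _ hP']
  refine ⟨w.num, w.denom, ?_, hwP⟩
  refine isCoprime_of_prime_dvd (fun h0 => hP h0.2) fun π hπ hπw hπP => ?_
  let v : HeightOneSpectrum K[X] := ⟨Ideal.span {π}, (Ideal.span_singleton_prime hπ.ne_zero).2 hπ,
    mt Ideal.span_singleton_eq_bot.1 hπ.ne_zero⟩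
  have hle : v.valuation (RatFunc K) w ≤ 1 := by
    rw [(isEquiv_valuation_placeAt v).le_one_iff_le_one, hw, map_div₀]
    exact (div_le_one₀ (zero_lt_iff.2 ((Valuation.ne_zero_iff _).2 hP'))).2
      (h v (Ideal.mem_span_singleton.2 hπP))
  rw [← RatFunc.num_div_denom w] at hle
  refine (v.valuation_div_le_one_iff _ w.num w.denom_ne_zero fun hden hnum => ?_).1 hle
    (Ideal.mem_span_singleton.2 hπw)
  exact hπ.not_isUnit (w.isCoprime_num_denom.isUnit_of_dvd' (Ideal.mem_span_singleton.1 hnum)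
    (Ideal.mem_span_singleton.1 hden))

end PolynomialPlace

section RootsOfUnity

open IsDedekindDomain IsLocalRing

variable {K : Type*} [Field K] {v : HeightOneSpectrum K[X]} {n : ℕ}

lemma algebraMap_one_sub_X_pow (n : ℕ) :
    algebraMap K[X] (RatFunc K) (1 - X ^ n) = 1 - RatFunc.X ^ n := by
  rw [map_sub, map_one, map_pow, RatFunc.algebraMap_X]

lemma one_sub_X_pow_ne_zero (hn : n ≠ 0) : (1 - X ^ n : K[X]) ≠ 0 := by
  rw [← neg_sub, neg_ne_zero]
  exact X_pow_sub_C_ne_zero (Nat.pos_of_ne_zero hn) 1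

lemma qIntPoly_dvd_one_sub_X_pow (n : ℕ) : qIntPoly K n ∣ 1 - X ^ n :=
  ⟨1 - X, (geom_sum_mul_neg X n).symm⟩

lemma cyclotomic_dvd_one_sub_X_pow (n : ℕ) : cyclotomic n K ∣ 1 - X ^ n :=
  dvd_sub_comm.1 (cyclotomic.dvd_X_pow_sub_one n K)

lemma squarefree_one_sub_X_pow [CharZero K] (hn : n ≠ 0) : Squarefree (1 - X ^ n : K[X]) := by
  have hsep := separable_X_pow_sub_C (1 : K) (Nat.cast_ne_zero.2 hn) one_ne_zero
  exact hsep.squarefree.squarefree_of_dvd (dvd_sub_comm.1 dvd_rfl)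

lemma reductionAt_X_pow_eq_one (hv : qIntPoly K n ∈ v.asIdeal) : reductionAt v X ^ n = 1 := by
  have h := reductionAt_eq_zero_iff.2 (Ideal.mem_of_dvd _ (qIntPoly_dvd_one_sub_X_pow n) hv)
  rw [map_sub, map_one, map_pow, sub_eq_zero] at h
  exact h.symm

lemma reductionAt_X_ne_one [CharZero K] (hn : n ≠ 0) (hv : qIntPoly K n ∈ v.asIdeal) :
    reductionAt v X ≠ 1 := fun h1 => by
  have := charZero_residueField_placeAt (v := v)
  have h := reductionAt_eq_zero_iff.2 hv
  simp [qIntPoly, h1, hn] at h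

lemma isCyclotomicPlace_placeAt [CharZero K] (hn : n ≠ 0) (hv : qIntPoly K n ∈ v.asIdeal) {m : ℕ}
    (hm : IsPrimitiveRoot (reductionAt v X) m) :
    IsCyclotomicPlace (placeAt v) RatFunc.X (reductionAt v X) m n where
  hasResidue := RatFunc.algebraMap_X (K := K) ▸ hasResidue_algebraMap X
  isPrimitiveRoot := hm
  dvd := (hm.pow_eq_one_iff_dvd n).1 (reductionAt_X_pow_eq_one hv)
  pow_ne_one h := by
    refine RatFunc.algebraMap_ne_zero (one_sub_X_pow_ne_zero (K := K) hn) ?_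
    rw [algebraMap_one_sub_X_pow, h, sub_self]
  valuation_le_of_lt_one x hx := by
    rw [← (isEquiv_valuation_placeAt v).lt_one_iff_lt_one] at hx
    rw [← (isEquiv_valuation_placeAt v).le_iff_le, ← algebraMap_one_sub_X_pow]
    exact valuation_le_of_lt_one_of_notMem_sq v
      (notMem_sq_of_squarefree v (squarefree_one_sub_X_pow hn)) hx

lemma isPrimitiveRoot_reductionAt_X_iff [CharZero K] (hn : n ≠ 0) :
    IsPrimitiveRoot (reductionAt v X) n ↔ cyclotomic n K ∈ v.asIdeal := by
  have := charZero_residueField_placeAt (v := v)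
  have : NeZero (n : ResidueField (placeAt v)) := ⟨Nat.cast_ne_zero.2 hn⟩
  have heval : reductionAt v (cyclotomic n K) =
      (cyclotomic n (ResidueField (placeAt v))).eval (reductionAt v X) := by
    rw [← map_cyclotomic n ((reductionAt v).comp C), eval_map, ← hom_eval₂, eval₂_C_X]
  rw [← reductionAt_eq_zero_iff, heval, ← isRoot_cyclotomic_iff, IsRoot.def]

lemma isGenericParameter_C {c : K} (hc : c ≠ 0) (hc_root : c ^ n = 1 → c = 1) :
    IsGenericParameter (placeAt v) (RatFunc.C c) (reductionAt v (C c)) n where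
  hasResidue := RatFunc.algebraMap_C c ▸ hasResidue_algebraMap (C c)
  ne_zero := (map_ne_zero ((reductionAt v).comp C)).2 hc
  eq_one_of_pow_eq_one h := by
    have hcn : (reductionAt v).comp C (c ^ n) = (reductionAt v).comp C 1 := by
      simpa using h
    rw [hc_root (((reductionAt v).comp C).injective hcn), map_one]

lemma mem_qIntPoly_of_mem_modulus (hn : n ≠ 1)
    (hv : qIntPoly K n * cyclotomic n K ^ 4 ∈ v.asIdeal) : qIntPoly K n ∈ v.asIdeal :=
  (v.isPrime.mem_or_mem hv).elim id fun h =>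
    Ideal.mem_of_dvd _ (cyclotomic_dvd_geom_sum_of_dvd K dvd_rfl hn) (v.isPrime.mem_of_pow_mem 4 h)

lemma valuation_one_sub_X_pow_pow_five_le (n : ℕ) :
    (placeAt v).valuation (1 - RatFunc.X ^ n) ^ 5 ≤
      (placeAt v).valuation (algebraMap K[X] (RatFunc K) (qIntPoly K n * cyclotomic n K ^ 4)) := by
  rw [← algebraMap_one_sub_X_pow, ← map_pow, ← map_pow, pow_succ']
  exact valuation_algebraMap_le_of_dvd (mul_dvd_mul (qIntPoly_dvd_one_sub_X_pow n)
    (pow_dvd_pow_of_dvd (cyclotomic_dvd_one_sub_X_pow n) 4))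

lemma valuation_one_sub_X_pow_le (hv : cyclotomic n K ∉ v.asIdeal) :
    (placeAt v).valuation (1 - RatFunc.X ^ n) ≤
      (placeAt v).valuation (algebraMap K[X] (RatFunc K) (qIntPoly K n * cyclotomic n K ^ 4)) := by
  have hunit := (hasResidue_algebraMap (v := v) (cyclotomic n K)).valuation_eq_one
    (mt reductionAt_eq_zero_iff.1 hv)
  rw [map_mul, map_mul, map_pow, map_pow, hunit, one_pow, mul_one, ← algebraMap_one_sub_X_pow]
  exact valuation_algebraMap_le_of_dvd (qIntPoly_dvd_one_sub_X_pow n)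

lemma valuation_lhsSum_sub_rhsSum_le_modulus [CharZero K] {c : K} {d M N : ℕ} {r : ℤ} (hn : n ≠ 1)
    (hdn : d.Coprime n) (hd : d ≠ 0) (hr : r + d * N = n) (hN : N < n) (hM : M = N ∨ M = n - 1)
    (hc : c ≠ 0) (hc_root : c ^ n = 1 → c = 1)
    (hden : qPoch (RatFunc.C c * RatFunc.X ^ (2 * r)) ((RatFunc.X : RatFunc K) ^ d) N ≠ 0)
    (hv : qIntPoly K n * cyclotomic n K ^ 4 ∈ v.asIdeal) :
    (placeAt v).valuation (lhsSum RatFunc.X (RatFunc.C c) d r M -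
        rhsSum RatFunc.X (RatFunc.C c) n d r N) ≤
      (placeAt v).valuation (algebraMap K[X] (RatFunc K) (qIntPoly K n * cyclotomic n K ^ 4)) := by
  have := charZero_residueField_placeAt (v := v)
  have hn0 := Nat.ne_zero_of_lt hN
  have hvn := mem_qIntPoly_of_mem_modulus hn hv
  have hγ := isGenericParameter_C (v := v) hc hc_root
  by_cases hcyc : cyclotomic n K ∈ v.asIdeal
  · have h := isCyclotomicPlace_placeAt hn0 hvn ((isPrimitiveRoot_reductionAt_X_iff hn0).2 hcyc)
    exact (h.valuation_lhsSum_sub_rhsSum_le_of_eq_or_eq hn hdn hd hr hN hγ hden hM).trans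
      (valuation_one_sub_X_pow_pow_five_le n)
  · have h := isCyclotomicPlace_placeAt hn0 hvn (IsPrimitiveRoot.orderOf _)
    have hm : orderOf (reductionAt v X) ≠ 1 :=
      mt orderOf_eq_one_iff.1 (reductionAt_X_ne_one hn0 hvn)
    have hdm := hdn.coprime_dvd_right h.dvd
    exact (Valuation.map_sub_le _ (h.valuation_lhsSum_le hm hdm hd hr hγ hM)
      (h.valuation_rhsSum_le hm hdm hd hr (add_mul_ne_zero hdn hr hN) hγ hden)).trans
        (valuation_one_sub_X_pow_le hcyc)

end RootsOfUnity

/-- Here `q = RatFunc.X` is the variable of the field `K(q)` of rational functions.  The constant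
`c` may be an indeterminate (take `K = ℚ(c)`) or a number. -/
theorem theorem5p1 {K : Type*} [Field K] [CharZero K] (c : K) (n d : ℕ) (r : ℤ) (M N : ℕ)
    (hn : 0 < n) (hd : 0 < d) (hgcd : Nat.gcd n d = 1)
    (hr_lower : (d : ℤ) + n - d * n ≤ r) (hr_upper : r ≤ n) (hmod : (n : ℤ) ≡ r [ZMOD d])
    (hN : (N : ℤ) = (n - r) / d) (hM : M = N ∨ M = n - 1)
    (hc : c ≠ 0) (hc_root : c ^ n = 1 → c = 1)
    (hden : qPoch (RatFunc.C c * RatFunc.X ^ (2 * r)) ((RatFunc.X : RatFunc K) ^ d) N ≠ 0) :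
    RatCongr (qIntPoly K n * Polynomial.cyclotomic n K ^ 4)
      (lhsSum RatFunc.X (RatFunc.C c) d r M)
      (rhsSum RatFunc.X (RatFunc.C c) n d r N) := by
  have hr : r + d * N = n := by
    rw [hN, Int.mul_ediv_cancel' hmod.symm.dvd, add_sub_cancel]
  have hNn : N < n := by
    have hle : (d : ℤ) * (N + 1) ≤ d * n := by linear_combination hr_lower + hr
    exact_mod_cast le_of_mul_le_mul_left hle (Int.natCast_pos.2 hd)
  rcases eq_or_ne n 1 with rfl | hn1
  · obtain rfl : N = 0 := Nat.lt_one_iff.1 hNn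
    obtain rfl : r = 1 := by simpa using hr
    obtain rfl : M = 0 := by simpa using hM
    have hX : 1 - (RatFunc.X : RatFunc K) ≠ 0 := by
      simpa [algebraMap_one_sub_X_pow] using
        RatFunc.algebraMap_ne_zero (one_sub_X_pow_ne_zero (K := K) one_ne_zero)
    exact ⟨0, 1, isCoprime_one_left, by simp [lhsSum, rhsSum, harmSum, qInt, hX]⟩
  have hP : qIntPoly K n * cyclotomic n K ^ 4 ≠ 0 :=
    mul_ne_zero (ne_zero_of_dvd_ne_zero (one_sub_X_pow_ne_zero hn.ne')
      (qIntPoly_dvd_one_sub_X_pow n)) (pow_ne_zero 4 (cyclotomic_ne_zero n K))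
  exact ratCongr_of_valuation_le hP fun v hv => valuation_lhsSum_sub_rhsSum_le_modulus hn1
    (Nat.coprime_comm.1 hgcd) hd.ne' hr hNn hM hc hc_root hden hv
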